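/- **Setting.** Let $\mathbb{K}$ be a number field of degree $d=r+2\ge 2$ with exactly one complex place, with real embeddings ordered as $\sigma_1,\dots,\sigma_r$ and a fixed complex embedding $\sigma_{\mathbb C}$. A basis $(e_1,\dots,e_d)$ of $\mathbb{K}/\mathbb{Q}$ is positive if $i\det(\sigma_j(e_k))>0$, where $\sigma_{r+1}=\sigma_{\mathbb C}$, $\sigma_{r+2}=\overline{\sigma_{\mathbb C}}$. For $z\in\mathbb{C}$ and $\underline\tau=(\tau_0,\dots,\tau_r)$ with $\Im\tau_j>0$ let, with $x=e^{2i\pi z}$ and $q_j=e^{2i\pi\tau_j}$, $$G_r(z,\underline\tau)=\prod_{m\in\mathbb{Z}_{\ge0}^{r+1}}\Bigl(1-x^{-1}\prod_j q_j^{m_j+1}\Bigr)\Bigl(1-x\prod_jq_j^{m_j}\Bigr)^{(-1)^r},$$ extended to $\underline\tau\in(\mathbb{C}\setminus\mathbb{R})^{r+1}$ by $G_r(z,\dots,-\tau_j,\dots)=G_r(z+\tau_j,\underline\tau)^{-1}$. Let $L$ be a lattice in $\mathbb{K}$ with a positive $\mathbb{Z}$-basis $B$, let $\Lambda=\mathrm{Hom}_{\mathbb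 Z}(L,\mathbb{Z})$ with dual basis $C$, and let $\underline a=(a_0,\dots,a_r)$ be linearly independent primitive elements of $\Lambda$. Write $\det_C(a_0,\dots,a_r,c)=s\,c(\gamma)$ for all $c\in\Lambda$, with $s>0$ an integer and $\gamma\in L$ primitive. A positive dual family is $(\alpha_0,\dots,\alpha_r)\in L^{r+1}$ with $a_j(\alpha_j)>0$ and $a_k(\alpha_j)=0$ for $k\ne j$; it is uniform of value $n$ if $a_j(\alpha_j)=n$ for all $j$, and the minimal such $n$ is denoted $t$. With $\underline\alpha$ a minimal uniform positive dual family (any positive dual family gives the same value) put $$G_{r,\underline a}(w,\sigma_{\mathbb C},\Lambda)=\prod_{\delta\in F/\mathbb{Z}\gamma}G_r\Bigl(\frac{w+\sigma_{\mathbb C}(\delta)}{\sigma_{\mathbb C}(\gamma)},\Bigl(\frac{\sigma_{\mathbb C}(\alpha_j)}{\sigma_{\mathbb C}(\gamma)}\Bigr)_j\Bigr),\qquad F=\{\delta\in L:\ 0\le a_j(\delta)<a_j(\alpha_j)\ \forall j\}.$$ **Arithmetic data.** Let $\mathfrak f\neq\mathcal O_{\mathbb K}$ be an integral ideal with $\mathfrak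 f\cap\mathbb{Z}=q\mathbb{Z}$, such that all units $\equiv1\bmod\mathfrak f$ have norm $+1$. Let $\varepsilon_1,\dots,\varepsilon_r$ be fundamental units of the group of units that are $\equiv1\bmod\mathfrak f$ and positive at all real embeddings. For $\rho\in\mathfrak S_r$ put $u_0=1$ and $u_j=\varepsilon_{\rho(1)}\cdots\varepsilon_{\rho(j)}$ ($1\le j\le r$). With a positive $\mathbb{Z}$-basis $B_{\mathbb K}$ of $\mathcal O_{\mathbb K}$ write $\det_{B_{\mathbb K}}(1,u_1,\dots,u_r,\cdot)=\tilde\lambda_\rho\tilde a$ with $\tilde\lambda_\rho>0$ an integer and $\tilde a$ primitive, and let $\tilde s_\rho,\tilde t_\rho,(\tilde\alpha_{\rho,j})_j$ be the quantities $s$, $t$ and a minimal uniform positive dual family for $(\tilde a,\tilde au_1,\dots,\tilde au_r)$ and the lattice $\mathcal O_{\mathbb K}$. For a non-zero integral ideal $I$ with $I\cap\mathbb{Z}=n\mathbb{Z}$ let $I^c=nI^{-1}$; $I$ is primitive if $I\not\subset m\mathcal O_{\mathbb K}$ for all integers $m\ge2$. A helper ideal is a primitive ideal $I$ with $\mathcal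 N(I^c)$ squarefree. For a prime $p\mid\tilde t_\rho$, a target ideal (for $\rho,p$) is a primitive ideal $I$ with $II^c=p^{v_p(\tilde t_\rho)}\mathcal O_{\mathbb K}$ and $\mathcal N(I)=p^{v_p(\tilde s_\rho)}$ such that (i) there are indices $1\le m_1<\dots<m_{k_0}\le r$, integers $n_{k,j}$, ideals $J_k\mid I^c$ and integers $w_k>0$ with $u_{m_k}+\sum_{j<m_k}n_{k,j}u_j\in J_k$, $IJ_k\subset p^{w_k}\mathcal O_{\mathbb K}$ and $\sum_kw_k=v_p(\tilde s_\rho)$; (ii) each $\tilde\alpha_{\rho,j}$ ($0\le j\le r$) is congruent to an integer modulo $I^c$. Let $\mathfrak a$ be a prime ideal of prime norm $N$, let $\mathfrak b$ be a non-zero integral ideal, and assume: - $(\ast)$ $\mathfrak f$ is a positive power of a prime ideal of prime norm, and for all $\rho$: $\tilde\lambda_\rho=1$, $\tilde t_\rho$ is coprime to $qN\mathcal N(\mathfrak b)$, and $\sigma_{\mathbb C}(\tilde\alpha_{\rho,j})\notin\mathbb{R}$ for $0\le j\le r$; - $(\ast\ast)$ for all $\rho$ and all primes $p\mid\tilde t_\rho$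 there is a target ideal; fix one, $I_{\rho,p}$; there are positive integers $k_\rho$ coprime to $q$ such that the class of $k_\rho\prod_{p\mid\tilde t_\rho}I_{\rho,p}$ in the wide ray class group modulo $\mathfrak f$ does not depend on $\rho$; - with $D=q\prod_\rho\prod_{p\mid\tilde t_\rho}p$, the integer $N$ is coprime to $D$, and $\mathfrak b$ is coprime to $DN$. Put $L=\mathfrak f\mathfrak b^{-1}$. A vector $h\in L$ is admissible if $h/q\equiv1\bmod L$ and $h/N$ generates $\mathfrak a^{-1}L/L$. For a vector $h$ which is a non-zero multiple by an integer and a unit of an admissible vector, let $a$ be the primitive element of $\mathrm{Hom}_{\mathbb Z}(L,\mathbb{Z})$ that is a positive rational multiple of $\det_{B_L}(h,u_1h,\dots,u_rh,\cdot)$ ($B_L$ a positive $\mathbb{Z}$-basis of $L$). For $\mu\in\{\pm1\}$, put $$G^{\mu}_{r,\mathfrak f,\mathfrak b,\mathfrak a}(u_1,\dots,u_r;h)=\frac{G_{r,(\mu a,\mu au_1,\dots,\mu au_r)}\bigl(\tfrac{\sigma_{\mathbb C}(h)}q,\sigma_{\mathbb C},\mathrm{Hom}_{\mathbb Z}(\mathfrak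 f\mathfrak b^{-1},\mathbb{Z})\bigr)^N}{G_{r,(\mu a,\mu au_1,\dots,\mu au_r)}\bigl(\tfrac{\sigma_{\mathbb C}(h)}q,\sigma_{\mathbb C},\mathrm{Hom}_{\mathbb Z}(\mathfrak f(\mathfrak b\mathfrak a)^{-1},\mathbb{Z})\bigr)}.$$ Let $\mathcal Z^1_{\mathfrak f}$ be the set of pairs $(n,\varepsilon)\in(\mathbb{Z}/q\mathbb{Z})^\times\times\mathcal O_{\mathbb K}^\times$ with $n\varepsilon\equiv1\bmod\mathfrak f$, two pairs being identified when they have the same $n$; in the expressions below a class is represented by any pair $(n,\varepsilon)$ with $n$ a positive integer. **Proposition.** Let $\mathfrak I$ be $\mathcal O_{\mathbb K}$ or a helper ideal coprime to $DN\mathcal N(\mathfrak b)$, let $\rho\in\mathfrak S_r$, and let $g,h$ be two admissible vectors such that, for some positive integers $m,m'$ coprime to $q$, $$(g)=q\frac{N}{\mathfrak a\mathfrak b}\,m\,\mathfrak I\prod_{p\mid\tilde t_\rho}I_{\rho,p},\qquad (h)=q\frac{N}{\mathfrak a\mathfrak b}\,m'\,\mathfrak I\prod_{p\mid\tilde t_\rho}I_{\rho,p}.$$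 Let $\mu,\nu\in\{\pm1\}$ and let $(u_1,\dots,u_r)$ be the unit system of $\rho$. Then: 1. there is a class in $\mathcal Z^1_{\mathfrak f}$ such that, for all its representatives $(n,\varepsilon)$, $$G^{\mu}_{r,\mathfrak f,\mathfrak b,\mathfrak a}(u_1,\dots,u_r;g)^\nu=G^{\mu}_{r,\mathfrak f,\mathfrak b,\mathfrak a}(u_1,\dots,u_r;n\varepsilon h)^\nu;$$ 2. for any choices of representatives of the classes on the two sides, $$\prod_{(n,\varepsilon)\in\mathcal Z^1_{\mathfrak f}}G^{\mu}_{r,\mathfrak f,\mathfrak b,\mathfrak a}(u_1,\dots,u_r;n\varepsilon g)^\nu=\prod_{(n,\varepsilon)\in\mathcal Z^1_{\mathfrak f}}G^{\mu}_{r,\mathfrak f,\mathfrak b,\mathfrak a}(u_1,\dots,u_r;n\varepsilon h)^\nu.$$ -/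

import Mathlib

open scoped nonZeroDivisors
open NumberField

noncomputable section

namespace ATRUnits

/-! ### The multiple elliptic Gamma functions `G_r` -/

/-- `G_r(z, τ)` for `τ` in the `(r+1)`-st power of the upper half-plane:
`∏_{m ≥ 0} (1 - |q^{m+1}| x⁻¹) (1 - |q^m| x)^{(-1)^r}`
with `x = exp(2πiz)` and `q_j = exp(2πiτ_j)`. -/
def nishizawaGUpper (r : ℕ) (z : ℂ) (τ : Fin (r + 1) → ℂ) : ℂ :=
  (∏' m : Fin (r + 1) → ℕ,
      (1 - (∏ j, Complex.exp (2 * Real.pi * Complex.I * τ j) ^ (m j + 1)) *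
        (Complex.exp (2 * Real.pi * Complex.I * z))⁻¹)) *
  (∏' m : Fin (r + 1) → ℕ,
      (1 - (∏ j, Complex.exp (2 * Real.pi * Complex.I * τ j) ^ (m j)) *
        Complex.exp (2 * Real.pi * Complex.I * z))) ^ ((-1 : ℤ) ^ r)

open Classical in
/-- `G_r(z, τ)` for `τ ∈ (ℂ ∖ ℝ)^{r+1}`, obtained by applying
`G_r(z, τ_0, …, -τ_j, …, τ_r) = G_r(z + τ_j, τ)⁻¹` to each parameter in the lower half-plane. -/
def nishizawaG (r : ℕ) (z : ℂ) (τ : Fin (r + 1) → ℂ) : ℂ :=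
  nishizawaGUpper r (z - ∑ j ∈ Finset.univ.filter (fun j => (τ j).im < 0), τ j)
      (fun j => if (τ j).im < 0 then -τ j else τ j) ^
    ((-1 : ℤ) ^ (Finset.univ.filter (fun j => (τ j).im < 0)).card)

/-! ### Geometric `G_r` functions

An oriented lattice of rank `r + 2` is given as the `ℤ`-span `L` of a basis `B` of a rational vector
space `V`; the dual lattice `Λ = Hom(L, ℤ)` consists of the `ℚ`-linear forms on `V` which are
integral on `L`, with the orientation of the basis dual to `B`. -/

section Geometric

variable {V : Type*} [AddCommGroup V] [Module ℚ V] {r : ℕ}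

/-- The lattice spanned by a basis. -/
def lat (B : Module.Basis (Fin (r + 2)) ℚ V) : Submodule ℤ V := Submodule.span ℤ (Set.range B)

/-- `v` is a primitive vector of the lattice of `B`. -/
def IsPrimitiveVec (B : Module.Basis (Fin (r + 2)) ℚ V) (v : V) : Prop :=
  v ∈ lat B ∧ ∀ n : ℤ, (∃ w ∈ lat B, n • w = v) → n = 1 ∨ n = -1

/-- `a` is integral on the lattice of `B`, that is, `a ∈ Λ`. -/
def IsIntegralForm (B : Module.Basis (Fin (r + 2)) ℚ V) (a : Module.Dual ℚ V) : Prop :=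
  ∀ v ∈ lat B, ∃ k : ℤ, a v = k

/-- `a` is a primitive vector of the dual lattice `Λ`. -/
def IsPrimitiveForm (B : Module.Basis (Fin (r + 2)) ℚ V) (a : Module.Dual ℚ V) : Prop :=
  IsIntegralForm B a ∧
    ∀ n : ℤ, (∃ c : Module.Dual ℚ V, IsIntegralForm B c ∧ n • c = a) → n = 1 ∨ n = -1

/-- The linear form `det_B(v_0, …, v_r, ·)`. -/
def detForm (B : Module.Basis (Fin (r + 2)) ℚ V) (v : Fin (r + 1) → V) : Module.Dual ℚ V :=
  B.det.toMultilinearMap.toLinearMap (Fin.snoc v 0 : Fin (r + 2) → V) (Fin.last (r + 1))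

/-- The determinant `det_C(a_0, …, a_r, c)` of linear forms in the basis `C` dual to `B`. -/
def dualDet (B : Module.Basis (Fin (r + 2)) ℚ V) (a : Fin (r + 1) → Module.Dual ℚ V)
    (c : Module.Dual ℚ V) : ℚ :=
  Matrix.det (Matrix.of fun j k : Fin (r + 2) =>
    (Fin.snoc a c : Fin (r + 2) → Module.Dual ℚ V) j (B k))

open Classical in
/-- For a non-zero `φ ∈ Λ`, the unique pair `(n, a)` with `n` a positive integer, `a ∈ Λ` primitive
and `φ = n a` (and `(0, 0)` if there is none). -/
def primPair (B : Module.Basis (Fin (r + 2)) ℚ V) (φ : Module.Dual ℚ V) : ℕ × Module.Dual ℚ V :=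
  if h : ∃ x : ℕ × Module.Dual ℚ V, 0 < x.1 ∧ IsPrimitiveForm B x.2 ∧ φ = x.1 • x.2
  then h.choose else (0, 0)

open Classical in
/-- The unique pair `(s, γ)` with `s` a positive integer, `γ ∈ L` primitive and
`det_C(a_0, …, a_r, c) = s c(γ)` for all `c` (and `(0, 0)` if there is none). -/
def gammaPair (B : Module.Basis (Fin (r + 2)) ℚ V) (a : Fin (r + 1) → Module.Dual ℚ V) : ℕ × V :=
  if h : ∃ x : ℕ × V, 0 < x.1 ∧ IsPrimitiveVec B x.2 ∧
      ∀ c : Module.Dual ℚ V, dualDet B a c = x.1 * c x.2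
  then h.choose else (0, 0)

/-- `α` is a positive dual family to `a` in `L`. -/
def IsPosDual (B : Module.Basis (Fin (r + 2)) ℚ V) (a : Fin (r + 1) → Module.Dual ℚ V)
    (α : Fin (r + 1) → V) : Prop :=
  ∀ j, α j ∈ lat B ∧ 0 < a j (α j) ∧ ∀ k, k ≠ j → a k (α j) = 0

/-- `α` is a uniform positive dual family to `a`: `a_j(α_j) = n` for all `j`. -/
def IsUniformDual (B : Module.Basis (Fin (r + 2)) ℚ V) (a : Fin (r + 1) → Module.Dual ℚ V)
    (n : ℕ) (α : Fin (r + 1) → V) : Prop :=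
  IsPosDual B a α ∧ ∀ j, a j (α j) = n

/-- The value `t` of the minimal uniform positive dual families to `a`. It is the largest elementary
divisor of the matrix of `a` in the basis `C`, i.e. the least `n > 0` such that `n ℤ^{r+1}` is
contained in the image of `L → ℤ^{r+1}, δ ↦ (a_j(δ))_j`. -/
def uniformIndex (B : Module.Basis (Fin (r + 2)) ℚ V) (a : Fin (r + 1) → Module.Dual ℚ V) : ℕ :=
  sInf {n : ℕ | 0 < n ∧ ∃ α, IsUniformDual B a n α}

open Classical in
/-- A minimal uniform positive dual family to `a`; its members are unique up to adding integer
multiples of `γ`. -/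
def minDual (B : Module.Basis (Fin (r + 2)) ℚ V) (a : Fin (r + 1) → Module.Dual ℚ V) :
    Fin (r + 1) → V :=
  if h : ∃ α, IsUniformDual B a (uniformIndex B a) α then h.choose else 0

/-- `F(α) = {δ ∈ L | 0 ≤ δ(a_j) < α_j(a_j) for all j}`. -/
def boxF (B : Module.Basis (Fin (r + 2)) ℚ V) (a : Fin (r + 1) → Module.Dual ℚ V)
    (α : Fin (r + 1) → V) : Set V :=
  {δ | δ ∈ lat B ∧ ∀ j, 0 ≤ a j δ ∧ a j δ < a j (α j)}

/-- The geometric function computed with the positive dual family `α`: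
`G_{r,a}^α(w, x, Λ) = ∏_{δ ∈ F(α)/ℤγ} G_r((w + δ(x))/γ(x), α(x)/γ(x))`. -/
def geomGWith (B : Module.Basis (Fin (r + 2)) ℚ V) (a : Fin (r + 1) → Module.Dual ℚ V)
    (α : Fin (r + 1) → V) (w : ℂ) (x : V →ₗ[ℚ] ℂ) : ℂ :=
  ∏ᶠ c ∈ ((fun δ : V => (δ : V ⧸ AddSubgroup.zmultiples (gammaPair B a).2)) '' boxF B a α),
    nishizawaG r ((w + x (Quotient.out c)) / x (gammaPair B a).2)
      (fun j => x (α j) / x (gammaPair B a).2)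

/-- The geometric function `G_{r,a}(w, x, Λ)`. It does not depend on the positive dual family; it is
computed here with a minimal uniform one. -/
def geomG (B : Module.Basis (Fin (r + 2)) ℚ V) (a : Fin (r + 1) → Module.Dual ℚ V)
    (w : ℂ) (x : V →ₗ[ℚ] ℂ) : ℂ :=
  geomGWith B a (minDual B a) w x

end Geometric

section Arithmetic

variable {K : Type*} [Field K] [NumberField K] {r : ℕ}

/-! ### Orientation, units -/

/-- The ordered embeddings `σ_1, …, σ_r, σ_ℂ, conj σ_ℂ`. -/
def embeddings (σR : Fin r ≃ (K →+* ℝ)) (σC : K →+* ℂ) : Fin (r + 2) → (K → ℂ) :=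
  Fin.snoc (Fin.snoc (fun i : Fin r => fun x : K => ((σR i x : ℝ) : ℂ)) (fun x => σC x) :
    Fin (r + 1) → (K → ℂ)) (fun x => (starRingEnd ℂ) (σC x))

/-- A basis of `K` is positive if the real number `i det(σ_j(e_k))` is positive. -/
def IsPositiveBasis (σR : Fin r ≃ (K →+* ℝ)) (σC : K →+* ℂ)
    (B : Module.Basis (Fin (r + 2)) ℚ K) : Prop :=
  0 < (Complex.I * Matrix.det (Matrix.of fun j k : Fin (r + 2) => embeddings σR σC j (B k))).re

/-- A fractional ideal as a `ℤ`-module. -/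
def toLattice (J : FractionalIdeal (𝓞 K)⁰ K) : Submodule ℤ K :=
  (J : Submodule (𝓞 K) K).restrictScalars ℤ

/-- `B` is a `ℤ`-basis of the fractional ideal `J`, and a positive basis of `K`. -/
def IsPositiveBasisOf (σR : Fin r ≃ (K →+* ℝ)) (σC : K →+* ℂ)
    (B : Module.Basis (Fin (r + 2)) ℚ K) (J : FractionalIdeal (𝓞 K)⁰ K) : Prop :=
  lat B = toLattice J ∧ IsPositiveBasis σR σC B

/-- The totally positive units congruent to `1` modulo `f`. -/
def IsPosUnit (f : Ideal (𝓞 K)) (ε : (𝓞 K)ˣ) : Prop :=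
  (ε : 𝓞 K) - 1 ∈ f ∧ ∀ τ : K →+* ℝ, 0 < τ ((ε : 𝓞 K) : K)

/-- `ε_1, …, ε_r` is a system of fundamental units of the group of totally positive units congruent
to `1` modulo `f` (a basis modulo torsion; that group has no torsion if `r ≥ 1`). -/
def IsFundamentalSystem (f : Ideal (𝓞 K)) (ε : Fin r → (𝓞 K)ˣ) : Prop :=
  (∀ i, IsPosUnit f (ε i)) ∧
    ∀ u : (𝓞 K)ˣ, IsPosUnit f u → ∃! n : Fin r → ℤ, IsOfFinOrder (u * (∏ i, ε i ^ n i)⁻¹)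

/-- `(u_0 = 1, u_1, …, u_r)` with `(u_1, …, u_r) = [ε_{ρ(1)} | … | ε_{ρ(r)}]`, i.e.
`u_j = ε_{ρ(1)} ⋯ ε_{ρ(j)}`. -/
def unitSystem (ε : Fin r → (𝓞 K)ˣ) (ρ : Equiv.Perm (Fin r)) : Fin (r + 1) → (𝓞 K)ˣ :=
  Fin.partialProd (fun i => ε (ρ i))

/-! ### The forms attached to a unit system and a vector, arithmetic `G_r` functions -/

/-- `det_B(h, u_1 h, …, u_r h, ·)`. -/
def unitForm (B : Module.Basis (Fin (r + 2)) ℚ K) (u : Fin (r + 1) → (𝓞 K)ˣ) (h : K) :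
    Module.Dual ℚ K :=
  detForm B (fun j => ((u j : 𝓞 K) : K) * h)

/-- The family `(a, a u_1, …, a u_r)`, where `a` is the primitive form which is a positive rational
multiple of `det_B(h, u_1 h, …, u_r h, ·)`. -/
def unitFamily (B : Module.Basis (Fin (r + 2)) ℚ K) (u : Fin (r + 1) → (𝓞 K)ˣ) (h : K) :
    Fin (r + 1) → Module.Dual ℚ K :=
  fun j => (primPair B (unitForm B u h)).2 ∘ₗ LinearMap.mulLeft ℚ ((u j : 𝓞 K) : K)

/-- The arithmetic function `G_{r,f,b,a}^μ(u_1, …, u_r; h)`, where `BL` and `BL'` are positive bases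
of `L = f b⁻¹` and `f (b a)⁻¹`. -/
def arithG (BL BL' : Module.Basis (Fin (r + 2)) ℚ K) (q N : ℕ) (σC : K →+* ℂ)
    (u : Fin (r + 1) → (𝓞 K)ˣ) (μ : ℤˣ) (h : K) : ℂ :=
  geomG BL (fun j => (μ : ℤ) • unitFamily BL u h j) (σC h / q) σC.toRatAlgHom.toLinearMap ^ N /
  geomG BL' (fun j => (μ : ℤ) • unitFamily BL u h j) (σC h / q) σC.toRatAlgHom.toLinearMap

/-! ### Quantities depending only on the unit system (`h = 1`, lattice `𝓞 K` with basis `BK`) -/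

/-- The content `λ̃` of the unit system. -/
def tlambda (BK : Module.Basis (Fin (r + 2)) ℚ K) (u : Fin (r + 1) → (𝓞 K)ˣ) : ℕ :=
  (primPair BK (unitForm BK u 1)).1

/-- The overflow `t̃` of the unit system. -/
def tt (BK : Module.Basis (Fin (r + 2)) ℚ K) (u : Fin (r + 1) → (𝓞 K)ˣ) : ℕ :=
  uniformIndex BK (unitFamily BK u 1)

/-- The product `s̃` of the elementary divisors of `(ã, ã u_1, …, ã u_r)`. -/
def ts (BK : Module.Basis (Fin (r + 2)) ℚ K) (u : Fin (r + 1) → (𝓞 K)ˣ) : ℕ :=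
  (gammaPair BK (unitFamily BK u 1)).1

/-- The minimal uniform positive dual family `α̃`. -/
def talpha (BK : Module.Basis (Fin (r + 2)) ℚ K) (u : Fin (r + 1) → (𝓞 K)ˣ) : Fin (r + 1) → K :=
  minDual BK (unitFamily BK u 1)

/-! ### Target ideals, helper ideals, admissible vectors -/

/-- `n` is the non-negative generator of `I ∩ ℤ`. -/
def IsMinInt (I : Ideal (𝓞 K)) (n : ℕ) : Prop :=
  I.comap (algebraMap ℤ (𝓞 K)) = Ideal.span {(n : ℤ)}

/-- `J` is the complementary ideal of `I`: `I J = n 𝓞 K` where `I ∩ ℤ = n ℤ`. -/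
def IsComplementary (I J : Ideal (𝓞 K)) : Prop :=
  ∃ n : ℕ, IsMinInt I n ∧ I * J = Ideal.span {(n : 𝓞 K)}

/-- Primitive ideals: non-zero, and not contained in `m 𝓞 K` for any integer `m ≥ 2`. -/
def IsPrimitiveIdeal (I : Ideal (𝓞 K)) : Prop :=
  I ≠ ⊥ ∧ ∀ m : ℕ, 2 ≤ m → ¬ I ≤ Ideal.span {(m : 𝓞 K)}

/-- Helper ideals: primitive, with complementary ideal of squarefree norm. -/
def IsHelperIdeal (I : Ideal (𝓞 K)) : Prop :=
  IsPrimitiveIdeal I ∧ ∃ J : Ideal (𝓞 K), IsComplementary I J ∧ Squarefree (Ideal.absNorm J)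

/-- `I` is a target ideal for the unit system `u` and the prime `p`. The set `S` is the set of the
indices `m_1 < … < m_{k_0}` in `{1, …, r}`, where `m : Fin r` stands for the index `m + 1`. -/
def IsTargetIdeal (BK : Module.Basis (Fin (r + 2)) ℚ K) (u : Fin (r + 1) → (𝓞 K)ˣ) (p : ℕ)
    (I : Ideal (𝓞 K)) : Prop :=
  p.Prime ∧ 0 < padicValNat p (tt BK u) ∧ IsPrimitiveIdeal I ∧
  ∃ Ic : Ideal (𝓞 K), IsComplementary I Ic ∧
    I * Ic = Ideal.span {((p ^ padicValNat p (tt BK u) : ℕ) : 𝓞 K)} ∧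
    Ideal.absNorm I = p ^ padicValNat p (ts BK u) ∧
    (∃ (S : Finset (Fin r)) (c : Fin r → Fin (r + 1) → ℤ) (J : Fin r → Ideal (𝓞 K))
        (w : Fin r → ℕ),
      (∀ m ∈ S, J m ∣ Ic ∧ 0 < w m ∧
        (u m.succ : 𝓞 K) + ∑ i ∈ Finset.Iio m.succ, (c m i : 𝓞 K) * (u i : 𝓞 K) ∈ J m ∧
        I * J m ≤ Ideal.span {((p ^ w m : ℕ) : 𝓞 K)}) ∧
      ∑ m ∈ S, w m = padicValNat p (ts BK u)) ∧
    ∀ j : Fin (r + 1), ∃ (n : ℤ) (y : 𝓞 K), y ∈ Ic ∧ talpha BK u j - n = (y : K)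

/-- Two integral ideals prime to `f` have the same class in the wide ray class group modulo `f`. -/
def SameRayClass (f A A' : Ideal (𝓞 K)) : Prop :=
  ∃ x y : 𝓞 K, x ≠ 0 ∧ y ≠ 0 ∧ x - 1 ∈ f ∧ y - 1 ∈ f ∧
    Ideal.span {x} * A = Ideal.span {y} * A'

/-- The product of the target ideals `T_{ρ,p}` over the primes `p` dividing `t̃_ρ`. -/
def targetProd (BK : Module.Basis (Fin (r + 2)) ℚ K) (ε : Fin r → (𝓞 K)ˣ)
    (T : Equiv.Perm (Fin r) → ℕ → Ideal (𝓞 K)) (ρ : Equiv.Perm (Fin r)) : Ideal (𝓞 K) :=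
  ∏ p ∈ (tt BK (unitSystem ε ρ)).primeFactors, T ρ p

/-- The conditions `(∗)` (`nb` is the norm of `b`). -/
def StarCondition (BK : Module.Basis (Fin (r + 2)) ℚ K) (σC : K →+* ℂ) (f : Ideal (𝓞 K))
    (ε : Fin r → (𝓞 K)ˣ) (q N nb : ℕ) : Prop :=
  (∃ (l : Ideal (𝓞 K)) (k : ℕ), 0 < k ∧ l.IsPrime ∧ (Ideal.absNorm l).Prime ∧ f = l ^ k) ∧
  ∀ ρ : Equiv.Perm (Fin r),
    tlambda BK (unitSystem ε ρ) = 1 ∧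
    (tt BK (unitSystem ε ρ)).Coprime (q * N * nb) ∧
    ∀ j, (σC (talpha BK (unitSystem ε ρ) j)).im ≠ 0

/-- The conditions `(∗∗)`, for the target ideals `T_{ρ,p}`. -/
def StarStarCondition (BK : Module.Basis (Fin (r + 2)) ℚ K) (f : Ideal (𝓞 K))
    (ε : Fin r → (𝓞 K)ˣ) (q : ℕ) (T : Equiv.Perm (Fin r) → ℕ → Ideal (𝓞 K)) : Prop :=
  (∀ ρ : Equiv.Perm (Fin r), ∀ p ∈ (tt BK (unitSystem ε ρ)).primeFactors,
    IsTargetIdeal BK (unitSystem ε ρ) p (T ρ p)) ∧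
  ∃ k : Equiv.Perm (Fin r) → ℕ, (∀ ρ, 0 < k ρ ∧ (k ρ).Coprime q) ∧
    ∀ ρ ρ', SameRayClass f (Ideal.span {(k ρ : 𝓞 K)} * targetProd BK ε T ρ)
      (Ideal.span {(k ρ' : 𝓞 K)} * targetProd BK ε T ρ')

/-- `D = q ∏_ρ ∏_{p ∣ t̃_ρ} p`. -/
def bigD (BK : Module.Basis (Fin (r + 2)) ℚ K) (ε : Fin r → (𝓞 K)ˣ) (q : ℕ) : ℕ :=
  q * ∏ ρ : Equiv.Perm (Fin r), ∏ p ∈ (tt BK (unitSystem ε ρ)).primeFactors, p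

/-- `h` is admissible for `f, b, a`: with `L = f b⁻¹`, `h ∈ L`, `h/q ≡ 1 mod L` and `h/N` generates
`a⁻¹L/L`. -/
def IsAdmissible (f b a : Ideal (𝓞 K)) (q N : ℕ) (h : K) : Prop :=
  let L : FractionalIdeal (𝓞 K)⁰ K := (f : FractionalIdeal (𝓞 K)⁰ K) / b
  h ∈ toLattice L ∧ h / q - 1 ∈ toLattice L ∧
    toLattice (L / (a : FractionalIdeal (𝓞 K)⁰ K)) =
      toLattice L ⊔ Submodule.span ℤ {h / (N : K)}

/-- `h` is an admissible generator of the fractional ideal `q (N / (a b)) m I P` for some positive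
integer `m` coprime to `q`. -/
def IsAdmissibleGenerator (f b a : Ideal (𝓞 K)) (q N : ℕ) (I P : Ideal (𝓞 K)) (h : K) : Prop :=
  IsAdmissible f b a q N h ∧ ∃ m : ℕ, 0 < m ∧ m.Coprime q ∧
    FractionalIdeal.spanSingleton (𝓞 K)⁰ h =
      ((Ideal.span {((q * N * m : ℕ) : 𝓞 K)} * I * P : Ideal (𝓞 K)) : FractionalIdeal (𝓞 K)⁰ K) /
        ((a * b : Ideal (𝓞 K)) : FractionalIdeal (𝓞 K)⁰ K)

/-! ### The finite set `𝒵_f^1` -/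

/-- The pairs `(n, ε)`, `n ∈ (ℤ/q)ˣ`, `ε ∈ (𝓞 K)ˣ`, with `n ε ≡ 1 mod f`. -/
def UnitPairs (f : Ideal (𝓞 K)) (q : ℕ) : Type _ :=
  {x : (ZMod q)ˣ × (𝓞 K)ˣ // ((x.1 : ZMod q).val : 𝓞 K) * (x.2 : 𝓞 K) - 1 ∈ f}

/-- Two pairs are equivalent if they have the same first component. -/
def unitPairsSetoid (f : Ideal (𝓞 K)) (q : ℕ) : Setoid (UnitPairs f q) :=
  Setoid.comap (fun x => x.1.1) ⊥

/-- The set `𝒵_f^1`. -/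
def ZfOne (f : Ideal (𝓞 K)) (q : ℕ) : Type _ := Quotient (unitPairsSetoid f q)

/-- The positive integer `n` and the unit `ε` represent the class `c ∈ 𝒵_f^1`. -/
def Represents (f : Ideal (𝓞 K)) (q : ℕ) (n : ℕ) (ε : (𝓞 K)ˣ) (c : ZfOne f q) : Prop :=
  0 < n ∧ ∃ x : UnitPairs f q, (n : ZMod q) = x.1.1 ∧ ε = x.1.2 ∧
    Quotient.mk (unitPairsSetoid f q) x = c

end Arithmetic

end ATRUnits

end

open ATRUnits

/-! The function $G(h)$ = `arithG` at $h$ has two symmetries. (a) For $v$ in both lattices,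
$G(kv)=G(k'v)$ for positive integers $k\equiv k'\bmod q$. The forms attached to $kv$ and $k'v$
agree, and with $k=k'+qj$ the argument $\sigma_{\mathbb C}(kv)/q$ moves by $\sigma_{\mathbb C}(jv)$.
All forms of the family vanish at $v$, so $jv\in\mathbb Z\gamma$, and each variable $z$ of $G_r$
moves by an integer (`arithG_natCast_mul`). (b) $G(\theta h)=G(h)$ for a unit $\theta$ of norm $1$:
the forms are composed with $\theta^{-1}$, $\gamma$ and the dual family are multiplied by $\theta$
(the latter up to $\mathbb Z\gamma$), and $\theta$ cancels in every quotient (`geomG_comp`,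
`arithG_unit_mul`).

Write $g=mv$ and $h=m'v'$. Then $(v)=(v')$, so $v=\eta v'$ for a unit $\eta$, and the congruences
$g/q\equiv h/q\equiv1\bmod L$ give $m'\equiv m\eta\bmod\mathfrak f$. Hence $n_0=m/m'\bmod q$
satisfies $n_0\eta\equiv1\bmod\mathfrak f$, and $(n_0,\eta)$ is the class sought in part 1. If
$(n,\eta')$ represents it, then $n\eta'h=\theta\,(nm')v$ with $nm'\equiv m\bmod q$ and
$\theta=\eta'\eta^{-1}\equiv1\bmod\mathfrak f$. This $\theta$ has norm $1$, so (a) and (b) apply.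
Part 2 is the same computation after reindexing one product by multiplication by this class. -/

noncomputable section

namespace ATRUnits

/-! ### Primitive elements of subgroups of rational vector spaces -/

section Primitive

variable {M : Type*} [AddCommGroup M] [Module ℚ M]

/-- `v` is a primitive element of the subgroup `P`. -/
def IsPrimitiveIn (P : AddSubgroup M) (v : M) : Prop :=
  v ∈ P ∧ ∀ n : ℤ, (∃ w ∈ P, n • w = v) → n = 1 ∨ n = -1

theorem zsmul_cancel_of_ne_zero {n : ℤ} (hn : n ≠ 0) {v w : M} (h : n • v = n • w) : v = w := by
  rw [← Int.cast_smul_eq_zsmul ℚ, ← Int.cast_smul_eq_zsmul ℚ] at h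
  have hn' : (n : ℚ) ≠ 0 := by exact_mod_cast hn
  have := congrArg (fun x => (n : ℚ)⁻¹ • x) h
  simpa [smul_smul, inv_mul_cancel₀ hn'] using this

theorem IsPrimitiveIn.ne_zero {M : Type*} [AddCommGroup M] {P : AddSubgroup M} {v : M} (hv : IsPrimitiveIn P v) : v ≠ 0 := by
  rintro rfl
  have := hv.2 2 ⟨0, P.zero_mem, by simp⟩
  omega

/-- After division by the gcd, $n'w=m'v$ with $n',m'$ coprime. A Bézout relation then exhibits $v$
as $n'$ times an element of $P$, and primitivity forces $n'=\pm1$. -/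
theorem IsPrimitiveIn.exists_eq_zsmul {P : AddSubgroup M} {v : M} (hv : IsPrimitiveIn P v) {w : M}
    (hw : w ∈ P) {n m : ℤ} (hn : n ≠ 0) (h : n • w = m • v) : ∃ k : ℤ, w = k • v := by
  obtain ⟨d, n', m', hd, hcop, rfl, rfl⟩ : ∃ d n' m' : ℤ, d ≠ 0 ∧ IsCoprime n' m' ∧
      n = d * n' ∧ m = d * m' := by
    obtain ⟨n', hn'⟩ := Int.gcd_dvd_left n m
    obtain ⟨m', hm'⟩ := Int.gcd_dvd_right n m
    have hd : (Int.gcd n m : ℤ) ≠ 0 := by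
      exact_mod_cast fun h0 => hn (Int.gcd_eq_zero_iff.mp h0).1
    refine ⟨Int.gcd n m, n', m', hd, ?_, hn', hm'⟩
    refine ⟨Int.gcdA n m, Int.gcdB n m, mul_left_cancel₀ hd ?_⟩
    have := Int.gcd_eq_gcd_ab n m
    rw [mul_one]
    conv_rhs => rw [this]
    conv_rhs => enter [1, 1]; rw [hn']
    conv_rhs => enter [2, 1]; rw [hm']
    ring
  rw [mul_smul, mul_smul] at h
  have h' := zsmul_cancel_of_ne_zero hd h
  obtain ⟨x, y, hxy⟩ := hcop
  have hvn : v = n' • (x • v + y • w) := by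
    calc v = (x * n' + y * m') • v := by rw [hxy, one_smul]
      _ = (x * n') • v + y • (m' • v) := by rw [add_smul, mul_smul y]
      _ = n' • (x • v + y • w) := by rw [← h', smul_add, mul_comm, mul_smul, smul_comm y]
  rcases hv.2 n' ⟨_, P.add_mem (P.zsmul_mem hv.1 x) (P.zsmul_mem hw y), hvn.symm⟩ with h1 | h1
  · exact ⟨m', by simpa [h1] using h'⟩
  · exact ⟨-m', by rw [neg_smul, ← h', h1]; simp⟩

theorem IsPrimitiveIn.eq_of_nsmul_eq {P : AddSubgroup M} {v v' : M} (hv : IsPrimitiveIn P v)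
    (hv' : IsPrimitiveIn P v') {n n' : ℕ} (hn : 0 < n) (hn' : 0 < n') (h : n • v = n' • v') :
    v = v' := by
  rw [← natCast_zsmul, ← natCast_zsmul] at h
  obtain ⟨k, hk⟩ := hv'.exists_eq_zsmul hv.1 (by omega) h
  rcases hv.2 k ⟨v', hv'.1, hk.symm⟩ with rfl | rfl
  · simpa using hk
  · exfalso
    apply hv'.ne_zero
    have h0 : ((n : ℤ) + n') • v' = ((n : ℤ) + n') • (0 : M) := by
      rw [smul_zero, add_smul, ← h, hk]; simp
    exact zsmul_cancel_of_ne_zero (by omega) h0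

end Primitive

/-! ### Primitive forms, the vector γ and dual families under lattice automorphisms -/

section Geometric

variable {V : Type*} [AddCommGroup V] [Module ℚ V] {r : ℕ}

/-- The dual lattice, as a subgroup of the space of linear forms. -/
def integralForms (B : Module.Basis (Fin (r + 2)) ℚ V) : AddSubgroup (Module.Dual ℚ V) where
  carrier := {a | IsIntegralForm B a}
  zero_mem' := fun v _ => ⟨0, by simp⟩
  add_mem' := fun {a b} ha hb v hv => by
    obtain ⟨k, hk⟩ := ha v hv
    obtain ⟨l, hl⟩ := hb v hv
    exact ⟨k + l, by simp [hk, hl]⟩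
  neg_mem' := fun {a} ha v hv => by
    obtain ⟨k, hk⟩ := ha v hv
    exact ⟨-k, by simp [hk]⟩

theorem isPrimitiveForm_iff (B : Module.Basis (Fin (r + 2)) ℚ V) (a : Module.Dual ℚ V) :
    IsPrimitiveForm B a ↔ IsPrimitiveIn (integralForms B) a := Iff.rfl

theorem isPrimitiveVec_iff (B : Module.Basis (Fin (r + 2)) ℚ V) (v : V) :
    IsPrimitiveVec B v ↔ IsPrimitiveIn (lat B).toAddSubgroup v := Iff.rfl

variable {B : Module.Basis (Fin (r + 2)) ℚ V}

theorem primPair_eq_zero {φ : Module.Dual ℚ V}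
    (h : ¬ ∃ x : ℕ × Module.Dual ℚ V, 0 < x.1 ∧ IsPrimitiveForm B x.2 ∧ φ = x.1 • x.2) :
    primPair B φ = (0, 0) := dif_neg h

theorem primPair_snd_eq {φ a : Module.Dual ℚ V} {n : ℕ} (hn : 0 < n) (ha : IsPrimitiveForm B a)
    (h : φ = n • a) : (primPair B φ).2 = a := by
  have hex : ∃ x : ℕ × Module.Dual ℚ V, 0 < x.1 ∧ IsPrimitiveForm B x.2 ∧ φ = x.1 • x.2 :=
    ⟨(n, a), hn, ha, h⟩
  rw [primPair, dif_pos hex]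
  obtain ⟨h1, h2, h3⟩ := hex.choose_spec
  exact IsPrimitiveIn.eq_of_nsmul_eq ((isPrimitiveForm_iff B _).1 h2) ha h1 hn (h3.symm.trans h)

theorem primPair_snd_apply_eq_zero {φ : Module.Dual ℚ V} {v : V} (h : φ v = 0) :
    (primPair B φ).2 v = 0 := by
  by_cases hex : ∃ x : ℕ × Module.Dual ℚ V, 0 < x.1 ∧ IsPrimitiveForm B x.2 ∧ φ = x.1 • x.2
  · obtain ⟨⟨n, a⟩, hn, ha, rfl⟩ := hex
    rw [primPair_snd_eq hn ha rfl]
    simpa [(show n ≠ 0 from hn.ne')] using h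
  · rw [primPair, dif_neg hex]; simp

/-- Integrality matters when `φ` has no pair of its own: half of a primitive form has none, although
its double does. For integral `φ`, a decomposition of `t • φ` descends to `φ`. -/
theorem primPair_snd_nsmul {φ : Module.Dual ℚ V} (hφ : IsIntegralForm B φ) {t : ℕ} (ht : 0 < t) :
    (primPair B (t • φ)).2 = (primPair B φ).2 := by
  by_cases hex : ∃ x : ℕ × Module.Dual ℚ V, 0 < x.1 ∧ IsPrimitiveForm B x.2 ∧ φ = x.1 • x.2
  · obtain ⟨⟨n, a⟩, hn, ha, rfl⟩ := hex
    rw [primPair_snd_eq hn ha rfl,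
      primPair_snd_eq (Nat.mul_pos ht hn) ha (mul_smul t n a).symm]
  · have hex' : ¬ ∃ x : ℕ × Module.Dual ℚ V, 0 < x.1 ∧ IsPrimitiveForm B x.2 ∧
        t • φ = x.1 • x.2 := by
      rintro ⟨⟨n, a⟩, hn, ha, h⟩
      dsimp only at hn ha h
      have ha' := (isPrimitiveForm_iff B a).1 ha
      rw [← natCast_zsmul, ← natCast_zsmul] at h
      obtain ⟨k, hk⟩ := ha'.exists_eq_zsmul (w := φ) hφ (by omega) h
      have hk0 : 0 < k := by
        have h1 : ((t : ℤ) * k - n) • a = ((t : ℤ) * k - n) • (0 : Module.Dual ℚ V) := by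
          rw [sub_smul, mul_smul, ← hk, h]; simp
        have h2 : (t : ℤ) * k - n = 0 := by
          by_contra h2
          exact ha'.ne_zero (zsmul_cancel_of_ne_zero h2 h1)
        have : 0 < (t : ℤ) * k := by omega
        exact pos_of_mul_pos_right this (by omega)
      lift k to ℕ using hk0.le
      exact hex ⟨(k, a), by exact_mod_cast hk0, ha, by simpa using hk⟩
    rw [primPair_eq_zero hex, primPair_eq_zero hex']

theorem mem_lat_symm {e : V ≃ₗ[ℚ] V} (he : ∀ v, e v ∈ lat B ↔ v ∈ lat B) (v : V) :
    e.symm v ∈ lat B ↔ v ∈ lat B := by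
  rw [← he, e.apply_symm_apply]

theorem IsIntegralForm.comp {e : V ≃ₗ[ℚ] V} (he : ∀ v, e v ∈ lat B ↔ v ∈ lat B)
    {a : Module.Dual ℚ V} (ha : IsIntegralForm B a) :
    IsIntegralForm B (a ∘ₗ (e : V →ₗ[ℚ] V)) :=
  fun v hv => ha (e v) ((he v).2 hv)

theorem IsPrimitiveForm.comp {e : V ≃ₗ[ℚ] V} (he : ∀ v, e v ∈ lat B ↔ v ∈ lat B)
    {a : Module.Dual ℚ V} (ha : IsPrimitiveForm B a) :
    IsPrimitiveForm B (a ∘ₗ (e : V →ₗ[ℚ] V)) := by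
  refine ⟨ha.1.comp he, ?_⟩
  rintro n ⟨c, hc, h⟩
  refine ha.2 n ⟨c ∘ₗ (e.symm : V →ₗ[ℚ] V), hc.comp (mem_lat_symm he), ?_⟩
  ext v
  simpa using LinearMap.congr_fun h (e.symm v)

theorem primPair_snd_comp {e : V ≃ₗ[ℚ] V} (he : ∀ v, e v ∈ lat B ↔ v ∈ lat B)
    (φ : Module.Dual ℚ V) :
    (primPair B (φ ∘ₗ (e : V →ₗ[ℚ] V))).2 = (primPair B φ).2 ∘ₗ (e : V →ₗ[ℚ] V) := by
  by_cases hex : ∃ x : ℕ × Module.Dual ℚ V, 0 < x.1 ∧ IsPrimitiveForm B x.2 ∧ φ = x.1 • x.2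
  · obtain ⟨⟨n, a⟩, hn, ha, rfl⟩ := hex
    rw [primPair_snd_eq hn ha rfl, primPair_snd_eq hn (ha.comp he) (LinearMap.smul_comp _ _ _)]
  · have hex' : ¬ ∃ x : ℕ × Module.Dual ℚ V, 0 < x.1 ∧ IsPrimitiveForm B x.2 ∧
        φ ∘ₗ (e : V →ₗ[ℚ] V) = x.1 • x.2 := by
      rintro ⟨⟨n, a⟩, hn, ha, h⟩
      refine hex ⟨(n, a ∘ₗ (e.symm : V →ₗ[ℚ] V)), hn, ha.comp (mem_lat_symm he), ?_⟩
      ext v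
      simpa using LinearMap.congr_fun h (e.symm v)
    rw [primPair_eq_zero hex, primPair_eq_zero hex', LinearMap.zero_comp]

theorem dualDet_apply_self (A : Fin (r + 1) → Module.Dual ℚ V) (j : Fin (r + 1)) :
    dualDet B A (A j) = 0 := by
  refine Matrix.det_zero_of_row_eq (i := j.castSucc) (j := Fin.last (r + 1))
    (Fin.castSucc_lt_last j).ne ?_
  ext k
  simp

/-- A nonzero determinant means that the $r+2$ forms separate vectors. -/
theorem eq_zero_of_dualDet_ne_zero {A : Fin (r + 1) → Module.Dual ℚ V} {c : Module.Dual ℚ V}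
    (h : dualDet B A c ≠ 0) {v : V} (hA : ∀ j, A j v = 0) (hc : c v = 0) : v = 0 := by
  have key : (B.repr v : Fin (r + 2) → ℚ) = 0 := by
    refine Matrix.eq_zero_of_mulVec_eq_zero h ?_
    have hform : ∀ a : Module.Dual ℚ V, ∑ k, a (B k) * B.repr v k = a v := by
      intro a
      conv_rhs => rw [← B.sum_repr v, map_sum]
      simp [mul_comm]
    ext j
    simp only [Matrix.mulVec, dotProduct, Matrix.of_apply, hform, Pi.zero_apply]
    refine Fin.lastCases ?_ (fun i => ?_) j
    · simpa using hc
    · simpa using hA i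
  exact B.repr.map_eq_zero_iff.mp (DFunLike.coe_injective key)

theorem dualDet_comp (e : V →ₗ[ℚ] V) (A : Fin (r + 1) → Module.Dual ℚ V) (c : Module.Dual ℚ V) :
    dualDet B (fun j => A j ∘ₗ e) (c ∘ₗ e) = LinearMap.det e * dualDet B A c := by
  rw [dualDet, dualDet, mul_comm, ← LinearMap.det_toMatrix B e, ← Matrix.det_mul]
  congr 1
  have hform : ∀ (a : Module.Dual ℚ V) (v : V), ∑ k, a (B k) * B.repr v k = a v := by
    intro a v
    conv_rhs => rw [← B.sum_repr v, map_sum]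
    simp [mul_comm]
  ext j k
  simp only [Matrix.mul_apply, Matrix.of_apply, LinearMap.toMatrix_apply, hform]
  refine Fin.lastCases ?_ (fun i => ?_) j <;> simp

/-- The defining property of the pair `(s, γ)`. -/
def IsGammaPair (B : Module.Basis (Fin (r + 2)) ℚ V) (A : Fin (r + 1) → Module.Dual ℚ V)
    (x : ℕ × V) : Prop :=
  0 < x.1 ∧ IsPrimitiveVec B x.2 ∧ ∀ c : Module.Dual ℚ V, dualDet B A c = x.1 * c x.2

theorem gammaPair_spec {A : Fin (r + 1) → Module.Dual ℚ V} (h : ∃ x, IsGammaPair B A x) :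
    IsGammaPair B A (gammaPair B A) := by
  have : gammaPair B A = h.choose := dif_pos h
  rw [this]
  exact h.choose_spec

theorem gammaPair_of_not {A : Fin (r + 1) → Module.Dual ℚ V} (h : ¬ ∃ x, IsGammaPair B A x) :
    gammaPair B A = (0, 0) := dif_neg h

theorem eq_of_forall_dual_eq (B : Module.Basis (Fin (r + 2)) ℚ V) {v w : V} (h : ∀ c : Module.Dual ℚ V, c v = c w) : v = w :=
  B.repr.injective (Finsupp.ext fun i => h (B.coord i))

theorem gammaPair_snd_eq {A : Fin (r + 1) → Module.Dual ℚ V} {s : ℕ} {γ : V}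
    (h : IsGammaPair B A (s, γ)) : (gammaPair B A).2 = γ := by
  obtain ⟨h1, h2, h3⟩ := gammaPair_spec ⟨_, h⟩
  refine IsPrimitiveIn.eq_of_nsmul_eq ((isPrimitiveVec_iff B _).1 h2) h.2.1 h1 h.1
    (eq_of_forall_dual_eq B fun c => ?_)
  simpa using (h3 c).symm.trans (h.2.2 c)

/-- The common kernel of the forms is the line $\mathbb Q\gamma$: if $c(\gamma)\ne0$, then
$\det(A,c)=s\,c(\gamma)\neq0$, so $c(\gamma)v-c(v)\gamma$, killed by $c$ and by all $A_j$, is zero.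
Primitivity of $\gamma$ turns the rational multiple into an integral one. -/
theorem IsGammaPair.exists_eq_zsmul {A : Fin (r + 1) → Module.Dual ℚ V} {x : ℕ × V}
    (h : IsGammaPair B A x) {v : V} (hv : v ∈ lat B) (hA : ∀ j, A j v = 0) :
    ∃ k : ℤ, v = k • x.2 := by
  obtain ⟨hs, hprim, hdet⟩ := h
  have hs' : (x.1 : ℚ) ≠ 0 := by exact_mod_cast hs.ne'
  obtain ⟨i, hi⟩ : ∃ i, B.repr x.2 i ≠ 0 := by
    by_contra! hall
    exact ((isPrimitiveVec_iff B _).1 hprim).ne_zero (B.repr.map_eq_zero_iff.mp (Finsupp.ext hall))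
  set c : Module.Dual ℚ V := B.coord i
  have hc : c x.2 ≠ 0 := hi
  -- A determinant with the row `A j` repeated vanishes, and it equals $s\,A_j(\gamma)$.
  have hAγ : ∀ j, A j x.2 = 0 := fun j => by
    have := hdet (A j)
    rw [dualDet_apply_self] at this
    exact (mul_eq_zero.mp this.symm).resolve_left hs'
  have hz : c x.2 • v - c v • x.2 = 0 := by
    refine eq_zero_of_dualDet_ne_zero (B := B) (A := A) (c := c) ?_ (fun j => ?_) ?_
    · rw [hdet]; exact mul_ne_zero hs' hc
    · simp [hA, hAγ]
    · simp [mul_comm]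
  set t : ℚ := c v / c x.2
  have hvt : v = t • x.2 := by
    rw [sub_eq_zero] at hz
    rw [show t = (c x.2)⁻¹ * c v by rw [mul_comm]; rfl, mul_smul, ← hz, smul_smul,
      inv_mul_cancel₀ hc, one_smul]
  refine ((isPrimitiveVec_iff B _).1 hprim).exists_eq_zsmul hv (n := t.den)
    (m := t.num) (by exact_mod_cast t.den_ne_zero) ?_
  rw [← Int.cast_smul_eq_zsmul ℚ, ← Int.cast_smul_eq_zsmul ℚ, hvt, smul_smul]
  congr 1
  rw [Int.cast_natCast, mul_comm]
  exact Rat.mul_den_eq_num t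

theorem IsPrimitiveVec.map {e : V ≃ₗ[ℚ] V} (he : ∀ v, e v ∈ lat B ↔ v ∈ lat B) {v : V}
    (hv : IsPrimitiveVec B v) : IsPrimitiveVec B (e v) := by
  refine ⟨(he v).2 hv.1, ?_⟩
  rintro n ⟨w, hw, h⟩
  refine hv.2 n ⟨e.symm w, (mem_lat_symm he w).2 hw, ?_⟩
  rw [← map_zsmul, h, e.symm_apply_apply]

theorem det_symm_eq_one {e : V ≃ₗ[ℚ] V} (hdet : LinearMap.det (e : V →ₗ[ℚ] V) = 1) :
    LinearMap.det (e.symm : V →ₗ[ℚ] V) = 1 := by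
  have := LinearEquiv.det_mul_det_symm e
  rwa [hdet, one_mul] at this

/-- Determinant $1$ fixes the sign: an automorphism of determinant $-1$ would send $\gamma$ to
$-e(\gamma)$. -/
theorem IsGammaPair.map {e : V ≃ₗ[ℚ] V} (he : ∀ v, e v ∈ lat B ↔ v ∈ lat B)
    (hdet : LinearMap.det (e : V →ₗ[ℚ] V) = 1) {A : Fin (r + 1) → Module.Dual ℚ V} {x : ℕ × V}
    (h : IsGammaPair B A x) :
    IsGammaPair B (fun j => A j ∘ₗ (e.symm : V →ₗ[ℚ] V)) (x.1, e x.2) := by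
  refine ⟨h.1, h.2.1.map he, fun c => ?_⟩
  have hc : c = (c ∘ₗ (e : V →ₗ[ℚ] V)) ∘ₗ (e.symm : V →ₗ[ℚ] V) := by ext v; simp
  conv_lhs => rw [hc, dualDet_comp, det_symm_eq_one hdet, one_mul, h.2.2]
  simp

theorem comp_symm_comp (e : V ≃ₗ[ℚ] V) (A : Fin (r + 1) → Module.Dual ℚ V) :
    (fun j => (A j ∘ₗ (e.symm : V →ₗ[ℚ] V)) ∘ₗ (e.symm.symm : V →ₗ[ℚ] V)) = A := by
  ext j v; simp

theorem exists_isGammaPair_comp_iff {e : V ≃ₗ[ℚ] V} (he : ∀ v, e v ∈ lat B ↔ v ∈ lat B)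
    (hdet : LinearMap.det (e : V →ₗ[ℚ] V) = 1) {A : Fin (r + 1) → Module.Dual ℚ V} :
    (∃ x, IsGammaPair B (fun j => A j ∘ₗ (e.symm : V →ₗ[ℚ] V)) x) ↔
      ∃ x, IsGammaPair B A x := by
  constructor
  · rintro ⟨x, hx⟩
    have := hx.map (mem_lat_symm he) (det_symm_eq_one hdet)
    rw [comp_symm_comp] at this
    exact ⟨_, this⟩
  · rintro ⟨x, hx⟩
    exact ⟨_, hx.map he hdet⟩

theorem gammaPair_snd_comp {e : V ≃ₗ[ℚ] V} (he : ∀ v, e v ∈ lat B ↔ v ∈ lat B)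
    (hdet : LinearMap.det (e : V →ₗ[ℚ] V) = 1) (A : Fin (r + 1) → Module.Dual ℚ V) :
    (gammaPair B (fun j => A j ∘ₗ (e.symm : V →ₗ[ℚ] V))).2 = e (gammaPair B A).2 := by
  by_cases h : ∃ x, IsGammaPair B A x
  · exact gammaPair_snd_eq ((gammaPair_spec h).map he hdet)
  · rw [gammaPair_of_not h, gammaPair_of_not (mt (exists_isGammaPair_comp_iff he hdet).1 h)]
    simp

theorem IsUniformDual.map {e : V ≃ₗ[ℚ] V} (he : ∀ v, e v ∈ lat B ↔ v ∈ lat B)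
    {A : Fin (r + 1) → Module.Dual ℚ V} {n : ℕ} {α : Fin (r + 1) → V}
    (h : IsUniformDual B A n α) :
    IsUniformDual B (fun j => A j ∘ₗ (e.symm : V →ₗ[ℚ] V)) n (fun j => e (α j)) := by
  refine ⟨fun j => ⟨(he _).2 (h.1 j).1, ?_, fun k hk => ?_⟩, fun j => ?_⟩
  · simpa using (h.1 j).2.1
  · simpa using (h.1 j).2.2 k hk
  · simpa using h.2 j

theorem exists_isUniformDual_comp_iff {e : V ≃ₗ[ℚ] V} (he : ∀ v, e v ∈ lat B ↔ v ∈ lat B)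
    {A : Fin (r + 1) → Module.Dual ℚ V} {n : ℕ} :
    (∃ α, IsUniformDual B (fun j => A j ∘ₗ (e.symm : V →ₗ[ℚ] V)) n α) ↔
      ∃ α, IsUniformDual B A n α := by
  constructor
  · rintro ⟨α, hα⟩
    have := hα.map (mem_lat_symm he)
    rw [comp_symm_comp] at this
    exact ⟨_, this⟩
  · rintro ⟨α, hα⟩
    exact ⟨_, hα.map he⟩

theorem uniformIndex_comp {e : V ≃ₗ[ℚ] V} (he : ∀ v, e v ∈ lat B ↔ v ∈ lat B)
    (A : Fin (r + 1) → Module.Dual ℚ V) :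
    uniformIndex B (fun j => A j ∘ₗ (e.symm : V →ₗ[ℚ] V)) = uniformIndex B A := by
  simp only [uniformIndex, exists_isUniformDual_comp_iff he]

theorem minDual_spec {A : Fin (r + 1) → Module.Dual ℚ V}
    (h : ∃ α, IsUniformDual B A (uniformIndex B A) α) :
    IsUniformDual B A (uniformIndex B A) (minDual B A) := by
  rw [minDual, dif_pos h]
  exact h.choose_spec

/-- Both families are arbitrary choices, so `e` need not carry one to the other. They take the same
values on all the forms, however, so they differ only in the common kernel, which periodicity
absorbs. When no uniform family exists, both choices are the default `0`. -/
theorem minDual_comp {e : V ≃ₗ[ℚ] V} (he : ∀ v, e v ∈ lat B ↔ v ∈ lat B)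
    (A : Fin (r + 1) → Module.Dual ℚ V) (j : Fin (r + 1)) :
    minDual B (fun j => A j ∘ₗ (e.symm : V →ₗ[ℚ] V)) j - e (minDual B A j) ∈ lat B ∧
      ∀ k, A k (e.symm (minDual B (fun j => A j ∘ₗ (e.symm : V →ₗ[ℚ] V)) j)) =
        A k (minDual B A j) := by
  by_cases h : ∃ α, IsUniformDual B A (uniformIndex B A) α
  · have h1 := minDual_spec h
    have h2 := minDual_spec (B := B) (A := fun j => A j ∘ₗ (e.symm : V →ₗ[ℚ] V)) (by
      rwa [uniformIndex_comp he, exists_isUniformDual_comp_iff he])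
    rw [uniformIndex_comp he] at h2
    refine ⟨sub_mem (h2.1 j).1 ((he _).2 (h1.1 j).1), fun k => ?_⟩
    rcases eq_or_ne k j with rfl | hk
    · exact (h2.2 k).trans (h1.2 k).symm
    · exact ((h2.1 j).2.2 k hk).trans ((h1.1 j).2.2 k hk).symm
  · have h' : ¬ ∃ α, IsUniformDual B (fun j => A j ∘ₗ (e.symm : V →ₗ[ℚ] V))
        (uniformIndex B (fun j => A j ∘ₗ (e.symm : V →ₗ[ℚ] V))) α := by
      rwa [uniformIndex_comp he, exists_isUniformDual_comp_iff he]
    simp [minDual, dif_neg h, dif_neg h']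

end Geometric

/-! ### Integer periodicity of $G_r$ -/

section Periodicity

theorem exp_two_pi_I_mul_add_int (z : ℂ) (k : ℤ) :
    Complex.exp (2 * Real.pi * Complex.I * (z + k)) =
      Complex.exp (2 * Real.pi * Complex.I * z) := by
  rw [mul_add, Complex.exp_add, mul_comm (2 * (Real.pi : ℂ) * Complex.I) (k : ℂ),
    Complex.exp_int_mul_two_pi_mul_I, mul_one]

theorem nishizawaGUpper_add_int (r : ℕ) (z : ℂ) (τ : Fin (r + 1) → ℂ) (k : ℤ)
    (l : Fin (r + 1) → ℤ) :
    nishizawaGUpper r (z + k) (fun j => τ j + l j) = nishizawaGUpper r z τ := by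
  simp only [nishizawaGUpper, exp_two_pi_I_mul_add_int]

theorem nishizawaG_add_int (r : ℕ) (z : ℂ) (τ : Fin (r + 1) → ℂ) (k : ℤ)
    (l : Fin (r + 1) → ℤ) :
    nishizawaG r (z + k) (fun j => τ j + l j) = nishizawaG r z τ := by
  classical
  -- Integer shifts do not change which parameters are reflected into the upper half-plane; the
  -- reflection only adds a further integer to the shift of `z`.
  have him : ∀ j, (τ j + l j).im = (τ j).im := fun j => by simp
  simp only [nishizawaG, him]
  congr 1
  set S := Finset.univ.filter fun j => (τ j).im < 0
  have h1 : z + k - ∑ j ∈ S, (τ j + l j) = z - ∑ j ∈ S, τ j + ((k - ∑ j ∈ S, l j : ℤ) : ℂ) := by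
    rw [Finset.sum_add_distrib]; push_cast; ring
  have h2 : (fun j => if (τ j).im < 0 then -(τ j + l j) else τ j + l j) =
      fun j => (if (τ j).im < 0 then -τ j else τ j) +
        ((if (τ j).im < 0 then -l j else l j : ℤ) : ℂ) := by
    ext j
    split_ifs <;> push_cast <;> ring
  rw [h1, h2, nishizawaGUpper_add_int]

end Periodicity

/-! ### Invariance of the geometric functions -/

section Geometric

variable {V : Type*} [AddCommGroup V] [Module ℚ V] {r : ℕ}
  {B : Module.Basis (Fin (r + 2)) ℚ V}

/-- A vector of the lattice on which all the forms vanish is a multiple of `γ` (when there is no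
`γ`, it is replaced by `0`, and then the quotients by `x γ` vanish). -/
theorem exists_div_gammaPair_eq_int {A : Fin (r + 1) → Module.Dual ℚ V} {v : V} (hv : v ∈ lat B)
    (hA : ∀ j, A j v = 0) (x : V →ₗ[ℚ] ℂ) :
    ∃ k : ℤ, x v / x (gammaPair B A).2 = k := by
  by_cases h : ∃ y, IsGammaPair B A y
  · obtain ⟨k, hk⟩ := (gammaPair_spec h).exists_eq_zsmul hv hA
    by_cases h0 : x (gammaPair B A).2 = 0
    · exact ⟨0, by simp [h0]⟩
    · refine ⟨k, ?_⟩
      rw [div_eq_iff h0]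
      conv_lhs => rw [hk]
      rw [map_zsmul, zsmul_eq_mul]
  · exact ⟨0, by simp [gammaPair_of_not h]⟩

theorem geomG_add_of_forall_eq_zero {A : Fin (r + 1) → Module.Dual ℚ V} {v : V} (hv : v ∈ lat B)
    (hA : ∀ j, A j v = 0) (w : ℂ) (x : V →ₗ[ℚ] ℂ) :
    geomG B A (w + x v) x = geomG B A w x := by
  obtain ⟨k, hk⟩ := exists_div_gammaPair_eq_int hv hA x
  simp only [geomG, geomGWith]
  refine finprod_mem_congr rfl fun c _ => ?_
  have := nishizawaG_add_int r ((w + x (Quotient.out c)) / x (gammaPair B A).2)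
    (fun j => x (minDual B A j) / x (gammaPair B A).2) k 0
  simp only [Pi.zero_apply, Int.cast_zero, add_zero] at this
  rw [← this, ← hk]
  congr 1
  ring

/-- The map `e` carries $\gamma$ to $\gamma'$ and the box classes modulo $\mathbb Z\gamma$
bijectively to those modulo $\mathbb Z\gamma'$, while the scalar `s` cancels in all quotients. The
chosen dual families and coset representatives match up to vectors whose quotient by $x(\gamma')$ is
an integer, so corresponding factors agree by periodicity. -/
theorem geomG_comp {e : V ≃ₗ[ℚ] V} (he : ∀ v, e v ∈ lat B ↔ v ∈ lat B)
    (hdet : LinearMap.det (e : V →ₗ[ℚ] V) = 1) (A : Fin (r + 1) → Module.Dual ℚ V)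
    {x : V →ₗ[ℚ] ℂ} {s : ℂ} (hs : s ≠ 0) (hx : ∀ v, x (e v) = s * x v) (w : ℂ) :
    geomG B (fun j => A j ∘ₗ (e.symm : V →ₗ[ℚ] V)) (s * w) x = geomG B A w x := by
  symm
  have hγ := gammaPair_snd_comp he hdet A
  have hα := minDual_comp he A
  set A' : Fin (r + 1) → Module.Dual ℚ V := fun j => A j ∘ₗ (e.symm : V →ₗ[ℚ] V) with hA'
  set γ := (gammaPair B A).2
  set γ' := (gammaPair B A').2
  have hbox : ∀ δ, e δ ∈ boxF B A' (minDual B A') ↔ δ ∈ boxF B A (minDual B A) := by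
    intro δ
    simp only [boxF, Set.mem_ofPred_eq, he]
    have h1 : ∀ j, A' j (e δ) = A j δ := fun j => by simp [hA']
    have h2 : ∀ j, A' j (minDual B A' j) = A j (minDual B A j) := fun j => (hα j).2 j
    simp only [h1, h2]
  have hmap : AddSubgroup.zmultiples γ ≤
      (AddSubgroup.zmultiples γ').comap (e : V →+ V) := by
    rw [AddSubgroup.zmultiples_le, AddSubgroup.mem_comap, hγ]
    exact AddSubgroup.mem_zmultiples _
  set E : V ⧸ AddSubgroup.zmultiples γ →+ V ⧸ AddSubgroup.zmultiples γ' :=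
    QuotientAddGroup.map _ _ (e : V →+ V) hmap
  have hEmk : ∀ v : V, E (v : V ⧸ AddSubgroup.zmultiples γ) = (e v : V) := fun v => rfl
  have hinj : Function.Injective E := by
    intro c d
    induction c using QuotientAddGroup.induction_on with | _ c => ?_
    induction d using QuotientAddGroup.induction_on with | _ d => ?_
    rw [hEmk, hEmk, QuotientAddGroup.eq, QuotientAddGroup.eq, hγ]
    rintro ⟨k, hk⟩
    refine ⟨k, e.injective ?_⟩
    simpa using hk
  simp only [geomG, geomGWith]
  refine finprod_mem_eq_of_bijOn E ⟨?_, hinj.injOn, ?_⟩ ?_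
  · rintro _ ⟨δ, hδ, rfl⟩
    exact ⟨e δ, (hbox δ).2 hδ, (hEmk δ).symm⟩
  · rintro _ ⟨δ, hδ, rfl⟩
    refine ⟨_, ⟨e.symm δ, (hbox _).1 (by simpa using hδ), rfl⟩, ?_⟩
    rw [hEmk, e.apply_symm_apply]
  · intro c _
    change nishizawaG r ((w + x (Quotient.out c)) / x γ) (fun j => x (minDual B A j) / x γ) =
      nishizawaG r ((s * w + x (Quotient.out (E c))) / x γ') fun j => x (minDual B A' j) / x γ'
    have hxγ : x γ' = s * x γ := by rw [hγ, hx]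
    have hl : ∀ j, ∃ k : ℤ, x (minDual B A' j - e (minDual B A j)) / x γ' = k := fun j =>
      exists_div_gammaPair_eq_int (hα j).1 (fun k => by
        simp only [hA', LinearMap.comp_apply, LinearEquiv.coe_coe, map_sub,
          LinearEquiv.symm_apply_apply]
        rw [sub_eq_zero]
        exact (hα j).2 k) x
    choose l hl using hl
    obtain ⟨k, hk⟩ : ∃ k : ℤ, x (Quotient.out (E c) - e (Quotient.out c)) / x γ' = k := by
      have hmem : -e (Quotient.out c) + Quotient.out (E c) ∈ AddSubgroup.zmultiples γ' := by
        rw [← QuotientAddGroup.eq, ← hEmk]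
        have h1 : ((Quotient.out c : V) : V ⧸ AddSubgroup.zmultiples γ) = c := Quotient.out_eq c
        have h2 : ((Quotient.out (E c) : V) : V ⧸ AddSubgroup.zmultiples γ') = E c :=
          Quotient.out_eq (E c)
        rw [h1, h2]
      obtain ⟨k, hk⟩ := hmem
      rw [neg_add_eq_sub] at hk
      by_cases h0 : x γ' = 0
      · exact ⟨0, by simp [h0]⟩
      · refine ⟨k, ?_⟩
        rw [div_eq_iff h0, ← hk]
        simp
    rw [← nishizawaG_add_int r _ _ k l]
    congr 1
    · rw [← hk, map_sub, hx, hxγ]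
      -- If $x(\gamma)=0$, all quotients are $0$ by convention and the identity still holds.
      by_cases h0 : x γ = 0
      · simp [h0]
      · field_simp; ring
    · ext j
      rw [← hl, map_sub, hx, hxγ]
      by_cases h0 : x γ = 0
      · simp [h0]
      · field_simp; ring

end Geometric

/-! ### Invariance of the arithmetic functions under integers and units -/

section Arithmetic

variable {K : Type*} [Field K] [NumberField K] {r : ℕ}

/-- Multiplication by a unit, as a `ℚ`-linear automorphism of `K`. -/
def unitMulEquiv (θ : (𝓞 K)ˣ) : K ≃ₗ[ℚ] K :=
  LinearEquiv.ofLinearMap (LinearMap.mulLeft ℚ ((θ : 𝓞 K) : K))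
    (LinearMap.mulLeft ℚ (((θ⁻¹ : (𝓞 K)ˣ) : 𝓞 K) : K))
    (by ext v; simp)
    (by ext v; simp)

@[simp]
theorem unitMulEquiv_apply (θ : (𝓞 K)ˣ) (v : K) :
    unitMulEquiv θ v = ((θ : 𝓞 K) : K) * v := rfl

theorem unitMulEquiv_symm_apply (θ : (𝓞 K)ˣ) (v : K) :
    (unitMulEquiv θ).symm v = (((θ⁻¹ : (𝓞 K)ˣ) : 𝓞 K) : K) * v := rfl

theorem det_unitMulEquiv {θ : (𝓞 K)ˣ} (hθ : Algebra.norm ℤ (θ : 𝓞 K) = 1) :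
    LinearMap.det (unitMulEquiv θ : K →ₗ[ℚ] K) = 1 := by
  have h : LinearMap.det (unitMulEquiv θ : K →ₗ[ℚ] K) = Algebra.norm ℚ ((θ : 𝓞 K) : K) :=
    (Algebra.norm_apply ℚ _).symm
  rw [h, ← Algebra.coe_norm_int, hθ, Int.cast_one]

theorem unit_mul_mem_toLattice {K : Type*} [Field K] {J : FractionalIdeal (𝓞 K)⁰ K} (θ : (𝓞 K)ˣ) {v : K}
    (hv : v ∈ toLattice J) : ((θ : 𝓞 K) : K) * v ∈ toLattice J := by
  have := (J : Submodule (𝓞 K) K).smul_mem (θ : 𝓞 K) hv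
  rwa [Algebra.smul_def] at this

theorem unitMulEquiv_mem_iff {B : Module.Basis (Fin (r + 2)) ℚ K} {J : FractionalIdeal (𝓞 K)⁰ K}
    (hB : lat B = toLattice J) (θ : (𝓞 K)ˣ) (v : K) : unitMulEquiv θ v ∈ lat B ↔ v ∈ lat B := by
  rw [hB]
  refine ⟨fun h => ?_, unit_mul_mem_toLattice θ⟩
  have := unit_mul_mem_toLattice θ⁻¹ h
  rwa [← unitMulEquiv_symm_apply, LinearEquiv.symm_apply_apply] at this

theorem det_mem_int_of_mem_lat {B : Module.Basis (Fin (r + 2)) ℚ K} {v : Fin (r + 2) → K}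
    (hv : ∀ i, v i ∈ lat B) : ∃ k : ℤ, B.det v = k := by
  have h : ∀ j i, ∃ k : ℤ, B.repr (v j) i = k := fun j i => by
    obtain ⟨k, hk⟩ := (B.mem_span_iff_repr_mem ℤ (v j)).1 (hv j) i
    exact ⟨k, hk.symm⟩
  choose M hM using h
  refine ⟨Matrix.det (Matrix.of fun i j => M j i), ?_⟩
  rw [B.det_apply, Int.cast_det]
  congr 1
  ext i j
  simp [Module.Basis.toMatrix_apply, hM]

variable {B BL BL' : Module.Basis (Fin (r + 2)) ℚ K} (u : Fin (r + 1) → (𝓞 K)ˣ)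

theorem unitForm_apply (h x : K) : unitForm B u h x =
    B.det (Fin.snoc (fun j => ((u j : 𝓞 K) : K) * h) x : Fin (r + 2) → K) := by
  simp only [unitForm, detForm, MultilinearMap.toLinearMap_apply, Fin.update_snoc_last]
  rfl

theorem unitForm_apply_self (h : K) (j : Fin (r + 1)) :
    unitForm B u h (((u j : 𝓞 K) : K) * h) = 0 := by
  rw [unitForm_apply]
  refine B.det.map_eq_zero_of_eq _ (i := j.castSucc) (j := Fin.last _) ?_
    (Fin.castSucc_lt_last j).ne
  simp

/-- Only $r+1$ of the $r+2$ columns are scaled; the last one carries the variable. -/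
theorem unitForm_natCast_mul (k : ℕ) (h : K) :
    unitForm B u ((k : K) * h) = k ^ (r + 1) • unitForm B u h := by
  ext x
  rw [LinearMap.smul_apply, unitForm_apply, unitForm_apply]
  have := B.det.toMultilinearMap.map_smul_univ
    (Fin.snoc (fun _ : Fin (r + 1) => (k : ℚ)) 1 : Fin (r + 2) → ℚ)
    (Fin.snoc (fun j => ((u j : 𝓞 K) : K) * h) x : Fin (r + 2) → K)
  rw [Fin.prod_univ_castSucc] at this
  simp only [Fin.snoc_castSucc, Fin.snoc_last, Finset.prod_const, Finset.card_univ,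
    Fintype.card_fin, mul_one, AlternatingMap.coe_multilinearMap] at this
  rw [← Nat.cast_smul_eq_nsmul ℚ, Nat.cast_pow, ← this]
  congr 1
  ext j
  refine Fin.lastCases ?_ (fun i => ?_) j
  · simp
  · simp only [Fin.snoc_castSucc, Algebra.smul_def, map_natCast]
    ring

/-- Writing the last entry as $\theta(\theta^{-1}x)$, the factor $\theta$ comes out of every column
and contributes its norm, which is $1$. -/
theorem unitForm_unit_mul {θ : (𝓞 K)ˣ} (hθ : Algebra.norm ℤ (θ : 𝓞 K) = 1) (h : K) :
    unitForm B u (((θ : 𝓞 K) : K) * h) =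
      unitForm B u h ∘ₗ ((unitMulEquiv θ).symm : K →ₗ[ℚ] K) := by
  ext x
  rw [LinearMap.comp_apply, unitForm_apply, unitForm_apply]
  have := B.det_comp (unitMulEquiv θ : K →ₗ[ℚ] K)
    (Fin.snoc (fun j => ((u j : 𝓞 K) : K) * h) ((unitMulEquiv θ).symm x) : Fin (r + 2) → K)
  rw [det_unitMulEquiv hθ, one_mul] at this
  rw [LinearEquiv.coe_coe, ← this]
  congr 1
  ext j
  refine Fin.lastCases ?_ (fun i => ?_) j
  · simp only [Fin.snoc_last, Function.comp_apply, LinearEquiv.coe_coe,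
      LinearEquiv.apply_symm_apply]
  · simp only [Fin.snoc_castSucc, Function.comp_apply, LinearEquiv.coe_coe, unitMulEquiv_apply]
    ring

theorem isIntegralForm_unitForm {J : FractionalIdeal (𝓞 K)⁰ K} (hB : lat B = toLattice J) {h : K}
    (hh : h ∈ lat B) : IsIntegralForm B (unitForm B u h) := by
  intro v hv
  rw [unitForm_apply]
  refine det_mem_int_of_mem_lat fun j => ?_
  refine Fin.lastCases ?_ (fun i => ?_) j
  · simpa using hv
  · rw [Fin.snoc_castSucc, hB]
    exact unit_mul_mem_toLattice _ (hB ▸ hh)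

theorem unitFamily_natCast_mul {J : FractionalIdeal (𝓞 K)⁰ K} (hB : lat B = toLattice J) {h : K}
    (hh : h ∈ lat B) {k : ℕ} (hk : 0 < k) :
    unitFamily B u ((k : K) * h) = unitFamily B u h := by
  ext j v
  rw [unitFamily, unitFamily, unitForm_natCast_mul,
    primPair_snd_nsmul (isIntegralForm_unitForm u hB hh) (pow_pos hk _)]

theorem unitFamily_unit_mul {J : FractionalIdeal (𝓞 K)⁰ K} (hB : lat B = toLattice J)
    {θ : (𝓞 K)ˣ} (hθ : Algebra.norm ℤ (θ : 𝓞 K) = 1) (h : K) (j : Fin (r + 1)) :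
    unitFamily B u (((θ : 𝓞 K) : K) * h) j =
      unitFamily B u h j ∘ₗ ((unitMulEquiv θ).symm : K →ₗ[ℚ] K) := by
  ext v
  simp only [unitFamily, unitForm_unit_mul u hθ,
    primPair_snd_comp (mem_lat_symm (unitMulEquiv_mem_iff hB θ)), LinearMap.comp_apply,
    LinearEquiv.coe_coe, unitMulEquiv_symm_apply, LinearMap.mulLeft_apply]
  congr 1
  ring

theorem unitFamily_apply_self (h : K) (j : Fin (r + 1)) : unitFamily B u h j h = 0 :=
  primPair_snd_apply_eq_zero (unitForm_apply_self u h j)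

theorem arithG_natCast_mul {J : FractionalIdeal (𝓞 K)⁰ K} (hBL : lat BL = toLattice J)
    {q N : ℕ} (hq : q ≠ 0) (σC : K →+* ℂ) (μ : ℤˣ) {v : K} (hv : v ∈ lat BL) (hv' : v ∈ lat BL')
    {k k' : ℕ} (hk : 0 < k) (hk' : 0 < k') (hkk' : (k : ZMod q) = k') :
    arithG BL BL' q N σC u μ ((k : K) * v) = arithG BL BL' q N σC u μ ((k' : K) * v) := by
  obtain ⟨j, hj⟩ : ∃ j : ℤ, (k : ℤ) = k' + q * j := by
    have h1 : ((k' : ℤ) : ZMod q) = (k : ℤ) := by simpa using hkk'.symm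
    obtain ⟨j, hj⟩ := (ZMod.intCast_eq_intCast_iff_dvd_sub _ _ _).1 h1
    exact ⟨j, by linarith⟩
  have hq' : (q : ℂ) ≠ 0 := by exact_mod_cast hq
  -- Since $k=k'+qj$, division by $q$ leaves exactly the lattice vector $jv$, on which all the forms
  -- vanish.
  have hw : σC ((k : K) * v) / q =
      σC ((k' : K) * v) / q + σC.toRatAlgHom.toLinearMap (j • v) := by
    have hjC : (k : ℂ) = k' + q * j := by exact_mod_cast hj
    have : σC.toRatAlgHom.toLinearMap (j • v) = j * σC v := by
      rw [map_zsmul, zsmul_eq_mul]; rfl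
    rw [this, map_mul, map_mul, map_natCast, map_natCast, hjC]
    field_simp
  have hA : ∀ i, ((μ : ℤ) • unitFamily BL u v i) (j • v) = 0 := fun i => by
    rw [LinearMap.smul_apply, map_zsmul, unitFamily_apply_self]; simp
  rw [arithG, arithG, hw, unitFamily_natCast_mul u hBL hv hk, unitFamily_natCast_mul u hBL hv hk',
    geomG_add_of_forall_eq_zero ((lat BL).smul_mem j hv) hA,
    geomG_add_of_forall_eq_zero ((lat BL').smul_mem j hv') hA]

theorem arithG_unit_mul {J J' : FractionalIdeal (𝓞 K)⁰ K} (hBL : lat BL = toLattice J)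
    (hBL' : lat BL' = toLattice J') {θ : (𝓞 K)ˣ} (hθ : Algebra.norm ℤ (θ : 𝓞 K) = 1)
    (q N : ℕ) (σC : K →+* ℂ) (μ : ℤˣ) (h : K) :
    arithG BL BL' q N σC u μ (((θ : 𝓞 K) : K) * h) = arithG BL BL' q N σC u μ h := by
  have hA : (fun j => (μ : ℤ) • unitFamily BL u (((θ : 𝓞 K) : K) * h) j) =
      fun j => ((μ : ℤ) • unitFamily BL u h j) ∘ₗ ((unitMulEquiv θ).symm : K →ₗ[ℚ] K) := by
    ext j : 1
    rw [unitFamily_unit_mul u hBL hθ, LinearMap.smul_comp]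
  have hs : σC ((θ : 𝓞 K) : K) ≠ 0 := by
    rw [Ne, map_eq_zero]
    exact_mod_cast θ.ne_zero
  have hx : ∀ v, σC.toRatAlgHom.toLinearMap (unitMulEquiv θ v) =
      σC ((θ : 𝓞 K) : K) * σC.toRatAlgHom.toLinearMap v := fun v => map_mul σC _ _
  rw [arithG, arithG, hA, map_mul, mul_div_assoc,
    geomG_comp (unitMulEquiv_mem_iff hBL θ) (det_unitMulEquiv hθ) _ hs hx,
    geomG_comp (unitMulEquiv_mem_iff hBL' θ) (det_unitMulEquiv hθ) _ hs hx]

end Arithmetic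

/-! ### The group structure of $\mathcal Z^1_{\mathfrak f}$ -/

section UnitPairs

variable {K : Type*} [Field K] {f : Ideal (𝓞 K)} {q : ℕ}

theorem natCast_sub_natCast_mem (hqf : (q : 𝓞 K) ∈ f) {n n' : ℕ} (h : (n : ZMod q) = n') :
    (n : 𝓞 K) - n' ∈ f := by
  obtain ⟨j, hj⟩ := (ZMod.intCast_eq_intCast_iff_dvd_sub n' n q).1 (by simpa using h.symm)
  have hj' : (n : 𝓞 K) - n' = q * j := by exact_mod_cast congrArg (Int.cast : ℤ → 𝓞 K) hj
  rw [hj']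
  exact f.mul_mem_right _ hqf

/-- Both units invert the same integer modulo `f`, so their quotient is $1$ modulo `f`. This
supplies the units to which the norm hypothesis applies. -/
theorem unit_mul_inv_sub_one_mem (hqf : (q : 𝓞 K) ∈ f) {n n' : ℕ} {η η' : (𝓞 K)ˣ}
    (h : (n : 𝓞 K) * η - 1 ∈ f) (h' : (n' : 𝓞 K) * η' - 1 ∈ f) (hn : (n : ZMod q) = n') :
    ((η' * η⁻¹ : (𝓞 K)ˣ) : 𝓞 K) - 1 ∈ f := by
  have h1 : (η : 𝓞 K) * ((η⁻¹ : (𝓞 K)ˣ) : 𝓞 K) = 1 := η.mul_inv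
  have h2 : ((η' * η⁻¹ : (𝓞 K)ˣ) : 𝓞 K) - 1 = ((η⁻¹ : (𝓞 K)ˣ) : 𝓞 K) *
      (η * ((n' : 𝓞 K) * η' - 1) - η' * ((n : 𝓞 K) * η - 1) + η * η' * ((n : 𝓞 K) - n')) := by
    rw [Units.val_mul]
    linear_combination (1 : 𝓞 K) * h1
  rw [h2]
  exact f.mul_mem_left _ (f.add_mem (f.sub_mem (f.mul_mem_left _ h') (f.mul_mem_left _ h))
    (f.mul_mem_left _ (natCast_sub_natCast_mem hqf hn)))

theorem mul_sub_one_mem_of_natCast_eq (hqf : (q : 𝓞 K) ∈ f) {n n' : ℕ} {η : 𝓞 K}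
    (h : (n : 𝓞 K) * η - 1 ∈ f) (hn : (n' : ZMod q) = n) : (n' : 𝓞 K) * η - 1 ∈ f := by
  have h1 : (n' : 𝓞 K) * η - 1 = ((n' : 𝓞 K) - n) * η + ((n : 𝓞 K) * η - 1) := by ring
  rw [h1]
  exact f.add_mem (f.mul_mem_right _ (natCast_sub_natCast_mem hqf hn)) h

theorem mul_mul_sub_one_mem {x y η ξ : 𝓞 K} (h : x * η - 1 ∈ f) (h' : y * ξ - 1 ∈ f) :
    x * y * (η * ξ) - 1 ∈ f := by
  have h1 : x * y * (η * ξ) - 1 = y * ξ * (x * η - 1) + (y * ξ - 1) := by ring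
  rw [h1]
  exact f.add_mem (f.mul_mem_left _ h) h'

theorem Represents.sub_one_mem [NeZero q] (hqf : (q : 𝓞 K) ∈ f) {n : ℕ} {η : (𝓞 K)ˣ}
    {c : ZfOne f q} (h : Represents f q n η c) : (n : 𝓞 K) * η - 1 ∈ f := by
  obtain ⟨-, x, hn, rfl, -⟩ := h
  exact mul_sub_one_mem_of_natCast_eq hqf x.2 (by simp [hn])

/-- The class of the first component in `(ℤ/q)ˣ`. -/
def ZfOne.fst (c : ZfOne f q) : (ZMod q)ˣ := Quotient.lift (fun x : UnitPairs f q => x.1.1)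
  (fun _ _ h => h) c

theorem ZfOne.fst_injective : Function.Injective (ZfOne.fst : ZfOne f q → (ZMod q)ˣ) := by
  intro c d
  induction c using Quotient.inductionOn
  induction d using Quotient.inductionOn
  intro h
  exact Quotient.sound h

theorem Represents.natCast_eq {n : ℕ} {η : (𝓞 K)ˣ} {c : ZfOne f q} (h : Represents f q n η c) :
    (n : ZMod q) = c.fst := by
  obtain ⟨-, x, hn, -, rfl⟩ := h
  exact hn

/-- The product of two pairs. -/
def UnitPairs.mul [NeZero q] (hqf : (q : 𝓞 K) ∈ f) (x y : UnitPairs f q) : UnitPairs f q :=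
  ⟨x.1 * y.1, by
    rw [Prod.snd_mul, Units.val_mul]
    refine mul_sub_one_mem_of_natCast_eq hqf
      (n := (x.1.1 : ZMod q).val * (y.1.1 : ZMod q).val) ?_ (by simp)
    rw [Nat.cast_mul]
    exact mul_mul_sub_one_mem x.2 y.2⟩

theorem unit_inv_mul_sub_one_mem [NeZero q] (hqf : (q : 𝓞 K) ∈ f) (x : UnitPairs f q) :
    (((x.1.1⁻¹ : (ZMod q)ˣ) : ZMod q).val : 𝓞 K) * ((x.1.2⁻¹ : (𝓞 K)ˣ) : 𝓞 K) - 1 ∈ f := by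
  set n := (x.1.1 : ZMod q).val
  set n' := ((x.1.1⁻¹ : (ZMod q)ˣ) : ZMod q).val
  set η := x.1.2
  have h : (n : 𝓞 K) * (η : 𝓞 K) - 1 ∈ f := x.2
  have h1 : (n : 𝓞 K) * n' - 1 ∈ f := by
    have := natCast_sub_natCast_mem (K := K) hqf (n := n * n') (n' := 1) (by simp [n, n'])
    simpa using this
  have h2 : (η : 𝓞 K) * ((η⁻¹ : (𝓞 K)ˣ) : 𝓞 K) = 1 := η.mul_inv
  have h3 : (n' : 𝓞 K) * ((η⁻¹ : (𝓞 K)ˣ) : 𝓞 K) - 1 =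
      ((n : 𝓞 K) * n' - 1) - n' * ((η⁻¹ : (𝓞 K)ˣ) : 𝓞 K) * ((n : 𝓞 K) * η - 1) := by
    linear_combination (n : 𝓞 K) * n' * h2
  rw [h3]
  exact f.sub_mem h1 (f.mul_mem_left _ h)

/-- Multiplication by a class is a bijection of `𝒵_f^1`. -/
theorem ZfOne.exists_bijective_fst_eq_mul [NeZero q] (hqf : (q : 𝓞 K) ∈ f) (x : UnitPairs f q) :
    ∃ e : ZfOne f q → ZfOne f q, Function.Bijective e ∧ ∀ c, (e c).fst = x.1.1 * c.fst := by
  have hmul : ∀ x : UnitPairs f q, ∃ e : ZfOne f q → ZfOne f q,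
      ∀ c, (e c).fst = x.1.1 * c.fst := by
    intro x
    refine ⟨Quotient.map (UnitPairs.mul hqf x) fun y z h => ?_, fun c => ?_⟩
    · have h' : y.1.1 = z.1.1 := h
      change x.1.1 * y.1.1 = x.1.1 * z.1.1
      rw [h']
    · induction c using Quotient.inductionOn
      rfl
  obtain ⟨e, he⟩ := hmul x
  obtain ⟨e', he'⟩ := hmul ⟨x.1⁻¹, unit_inv_mul_sub_one_mem hqf x⟩
  have he'' : ∀ c, (e' c).fst = x.1.1⁻¹ * c.fst := he'
  refine ⟨e, Function.bijective_iff_has_inverse.2 ⟨e', fun c => ?_, fun c => ?_⟩, he⟩ <;>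
    exact ZfOne.fst_injective (by simp [he, he''])

end UnitPairs

/-! ### Admissible generators -/

section Generators

variable {K : Type*} [Field K] [NumberField K]

/-- Multiplying by $n\in\mathfrak b$ gives $ny\in\mathfrak f$; also $qy\in\mathfrak f$, and $n,q$
are coprime. -/
theorem mem_of_coe_mem_div {f b : Ideal (𝓞 K)} {q n : ℕ} (hb : b ≠ ⊥) (hqf : (q : 𝓞 K) ∈ f)
    (hnb : (n : 𝓞 K) ∈ b) (hnq : n.Coprime q) {y : 𝓞 K}
    (hy : (y : K) ∈ toLattice ((f : FractionalIdeal (𝓞 K)⁰ K) / (b : FractionalIdeal (𝓞 K)⁰ K))) : y ∈ f := by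
  have hb' : (b : FractionalIdeal (𝓞 K)⁰ K) ≠ 0 := FractionalIdeal.coeIdeal_ne_zero.2 hb
  have h1 : y * n ∈ f := by
    have h2 : ((y : K)) * ((n : 𝓞 K) : K) ∈
        ((f : FractionalIdeal (𝓞 K)⁰ K) / (b : FractionalIdeal (𝓞 K)⁰ K)) * (b : FractionalIdeal (𝓞 K)⁰ K) :=
      FractionalIdeal.mul_mem_mul hy (FractionalIdeal.mem_coeIdeal_of_mem _ hnb)
    rw [div_mul_cancel₀ _ hb', FractionalIdeal.mem_coeIdeal] at h2
    obtain ⟨z, hz, hzy⟩ := h2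
    have : z = y * n := RingOfIntegers.coe_injective (by rw [map_mul]; exact hzy)
    exact this ▸ hz
  obtain ⟨s, t, hst⟩ := Nat.isCoprime_iff_coprime.2 hnq
  have hst' : (s : 𝓞 K) * n + t * q = 1 := by exact_mod_cast congrArg (Int.cast : ℤ → 𝓞 K) hst
  have h3 : y = s * (y * n) + y * t * q := by linear_combination -y * hst'
  rw [h3]
  exact f.add_mem (f.mul_mem_left _ h1) (f.mul_mem_left _ hqf)

/-- Removing the integer $m$ leaves a vector whose ideal no longer depends on the generator, so two
such vectors differ by a unit. -/
theorem IsAdmissibleGenerator.exists_eq_natCast_mul {f b a : Ideal (𝓞 K)} {q N : ℕ}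
    {I P : Ideal (𝓞 K)} {h : K} (hh : IsAdmissibleGenerator f b a q N I P h) :
    ∃ (m : ℕ) (v : K), 0 < m ∧ m.Coprime q ∧ h = m * v ∧
      FractionalIdeal.spanSingleton (𝓞 K)⁰ v =
        ((Ideal.span {((q * N : ℕ) : 𝓞 K)} * I * P : Ideal (𝓞 K)) : FractionalIdeal (𝓞 K)⁰ K) /
          ((a * b : Ideal (𝓞 K)) : FractionalIdeal (𝓞 K)⁰ K) := by
  obtain ⟨-, m, hm, hmq, hspan⟩ := hh
  have hm0 : (m : K) ≠ 0 := by exact_mod_cast hm.ne'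
  refine ⟨m, h / m, hm, hmq, by field_simp, ?_⟩
  have hm' : FractionalIdeal.spanSingleton (𝓞 K)⁰ (m : K) ≠ 0 :=
    FractionalIdeal.spanSingleton_ne_zero_iff.2 hm0
  refine mul_left_cancel₀ hm' ?_
  rw [FractionalIdeal.spanSingleton_mul_spanSingleton, mul_div_cancel₀ _ hm0, hspan,
    ← mul_div_assoc]
  congr 1
  have hmspan : FractionalIdeal.spanSingleton (𝓞 K)⁰ (m : K) =
      ((Ideal.span {(m : 𝓞 K)} : Ideal (𝓞 K)) : FractionalIdeal (𝓞 K)⁰ K) := by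
    rw [FractionalIdeal.coeIdeal_span_singleton, map_natCast]
  rw [hmspan, ← FractionalIdeal.coeIdeal_mul, ← mul_assoc, ← mul_assoc,
    Ideal.span_singleton_mul_span_singleton]
  congr 5
  push_cast
  ring

/-- Since $q\in\mathfrak f$ and $N\in\mathfrak a$, the numerator lies in $\mathfrak f\mathfrak a$;
the factor $\mathfrak a$ cancels for the first lattice and is dropped for the second. -/
theorem mem_toLattice_of_spanSingleton_eq {f b a : Ideal (𝓞 K)} (ha : a ≠ ⊥)
    {q N : ℕ} (hqf : (q : 𝓞 K) ∈ f) (hNa : (N : 𝓞 K) ∈ a) {I P : Ideal (𝓞 K)} {v : K}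
    (hv : FractionalIdeal.spanSingleton (𝓞 K)⁰ v =
      ((Ideal.span {((q * N : ℕ) : 𝓞 K)} * I * P : Ideal (𝓞 K)) : FractionalIdeal (𝓞 K)⁰ K) /
        ((a * b : Ideal (𝓞 K)) : FractionalIdeal (𝓞 K)⁰ K)) :
    v ∈ toLattice ((f : FractionalIdeal (𝓞 K)⁰ K) / (b : FractionalIdeal (𝓞 K)⁰ K)) ∧
      v ∈ toLattice ((f : FractionalIdeal (𝓞 K)⁰ K) /
        ((b * a : Ideal (𝓞 K)) : FractionalIdeal (𝓞 K)⁰ K)) := by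
  have ha' : (a : FractionalIdeal (𝓞 K)⁰ K) ≠ 0 := FractionalIdeal.coeIdeal_ne_zero.2 ha
  have hle : Ideal.span {((q * N : ℕ) : 𝓞 K)} * I * P ≤ f * a := by
    refine Ideal.mul_le_left.trans (Ideal.mul_le_left.trans ?_)
    rw [Ideal.span_singleton_le_iff_mem, Nat.cast_mul]
    exact Ideal.mul_mem_mul hqf hNa
  have hmono : ∀ {X Y : Ideal (𝓞 K)}, X ≤ Y → ∀ J : FractionalIdeal (𝓞 K)⁰ K,
      (X : FractionalIdeal (𝓞 K)⁰ K) / J ≤ (Y : FractionalIdeal (𝓞 K)⁰ K) / J := by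
    intro X Y hXY J
    rw [div_eq_mul_inv, div_eq_mul_inv]
    exact mul_le_mul_left ((FractionalIdeal.coeIdeal_le_coeIdeal K).2 hXY) _
  have hself : v ∈ FractionalIdeal.spanSingleton (𝓞 K)⁰ v :=
    FractionalIdeal.mem_spanSingleton_self _ _
  constructor
  · have h1 := hv.le.trans (hmono hle _)
    rw [mul_comm a b, FractionalIdeal.coeIdeal_mul, FractionalIdeal.coeIdeal_mul,
      mul_div_mul_right _ _ ha'] at h1
    exact h1 hself
  · have h1 := hv.le.trans (hmono (hle.trans Ideal.mul_le_left) _)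
    rw [mul_comm a b] at h1
    exact h1 hself

end Generators

end ATRUnits

end

/-! ### The proposition -/

theorem proposition26 {K : Type*} [Field K] [NumberField K] {r : ℕ}
    -- `K` has degree `r + 2` and exactly one complex place; its embeddings are ordered
    (hdeg : Module.finrank ℚ K = r + 2)
    (hATR : NumberField.InfinitePlace.nrComplexPlaces K = 1)
    (σR : Fin r ≃ (K →+* ℝ)) (σC : K →+* ℂ)
    (hσC : ¬ NumberField.ComplexEmbedding.IsReal σC)
    -- the ideals `f`, `b`, `a`, with `f ∩ ℤ = q ℤ` and `N` the norm of `a`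
    (f b a : Ideal (𝓞 K)) (q N : ℕ) (hq : IsMinInt f q) (hN : Ideal.absNorm a = N)
    -- all units congruent to `1` modulo `f` have norm `1`
    (hnorm : ∀ ε : (𝓞 K)ˣ, (ε : 𝓞 K) - 1 ∈ f → Algebra.norm ℤ (ε : 𝓞 K) = 1)
    -- positive bases of `𝓞 K`, `L = f b⁻¹` and `f (b a)⁻¹`
    (BK BL BL' : Module.Basis (Fin (r + 2)) ℚ K)
    (hBK : IsPositiveBasisOf σR σC BK 1)
    (hBL : IsPositiveBasisOf σR σC BL ((f : FractionalIdeal (𝓞 K)⁰ K) / b))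
    (hBL' : IsPositiveBasisOf σR σC BL'
      ((f : FractionalIdeal (𝓞 K)⁰ K) / ((b * a : Ideal (𝓞 K)) : FractionalIdeal (𝓞 K)⁰ K)))
    -- the fundamental units and the target ideals
    (ε : Fin r → (𝓞 K)ˣ) (hε : IsFundamentalSystem f ε)
    (hstar : StarCondition BK σC f ε q N (Ideal.absNorm b))
    (T : Equiv.Perm (Fin r) → ℕ → Ideal (𝓞 K)) (hstarstar : StarStarCondition BK f ε q T)
    -- the choice of `a` and `b`
    (ha : a.IsPrime) (hNprime : N.Prime) (hND : N.Coprime (bigD BK ε q))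
    (hb : b ≠ ⊥) (hbD : (Ideal.absNorm b).Coprime (bigD BK ε q * N))
    -- the helper ideal
    (I : Ideal (𝓞 K))
    (hI : I = ⊤ ∨ (IsHelperIdeal I ∧
      IsCoprime I (Ideal.span {((bigD BK ε q * N * Ideal.absNorm b : ℕ) : 𝓞 K)})))
    -- the permutation, the two admissible vectors and the orientations
    (ρ : Equiv.Perm (Fin r)) (g h : K)
    (hg : IsAdmissibleGenerator f b a q N I (targetProd BK ε T ρ) g)
    (hh : IsAdmissibleGenerator f b a q N I (targetProd BK ε T ρ) h)
    (μ ν : ℤˣ) :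
    (∃ c : ZfOne f q, ∀ (n : ℕ) (η : (𝓞 K)ˣ), Represents f q n η c →
      arithG BL BL' q N σC (unitSystem ε ρ) μ g ^ (ν : ℤ) =
        arithG BL BL' q N σC (unitSystem ε ρ) μ ((n : K) * ((η : 𝓞 K) : K) * h) ^ (ν : ℤ)) ∧
    (∀ (n n' : ZfOne f q → ℕ) (η η' : ZfOne f q → (𝓞 K)ˣ),
      (∀ c, Represents f q (n c) (η c) c) → (∀ c, Represents f q (n' c) (η' c) c) →
      ∏ᶠ c : ZfOne f q, arithG BL BL' q N σC (unitSystem ε ρ) μ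
          ((n c : K) * ((η c : 𝓞 K) : K) * g) ^ (ν : ℤ) =
        ∏ᶠ c : ZfOne f q, arithG BL BL' q N σC (unitSystem ε ρ) μ
          ((n' c : K) * ((η' c : 𝓞 K) : K) * h) ^ (ν : ℤ)) := by
  have hf0 : f ≠ ⊥ := by
    obtain ⟨⟨l, k, hk, -, hl, rfl⟩, -⟩ := hstar
    refine pow_ne_zero k fun h0 => hl.ne_zero ?_
    rw [h0]
    exact Ideal.absNorm_bot
  have hqf : (q : 𝓞 K) ∈ f := by
    have h1 : (q : ℤ) ∈ f.comap (algebraMap ℤ (𝓞 K)) := by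
      rw [hq]; exact Ideal.mem_span_singleton_self _
    simpa using Ideal.mem_comap.1 h1
  have hq0 : q ≠ 0 := by
    rintro rfl
    have h1 : ((Ideal.absNorm f : ℕ) : ℤ) ∈ f.comap (algebraMap ℤ (𝓞 K)) :=
      Ideal.mem_comap.2 (by simpa using Ideal.absNorm_mem f)
    rw [hq] at h1
    have h2 : Ideal.absNorm f = 0 := by simpa using h1
    exact hf0 (Ideal.absNorm_eq_zero_iff.1 h2)
  have : NeZero q := ⟨hq0⟩
  have ha0 : a ≠ ⊥ := by
    rintro rfl
    rw [Ideal.absNorm_bot] at hN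
    exact hNprime.ne_zero hN.symm
  have hNa : (N : 𝓞 K) ∈ a := hN ▸ Ideal.absNorm_mem a
  have hbq : (Ideal.absNorm b).Coprime q :=
    Nat.Coprime.coprime_dvd_right ((Dvd.intro _ rfl : q ∣ bigD BK ε q).mul_right N) hbD
  obtain ⟨m, v, hm, hmq, hgv, hv⟩ := hg.exists_eq_natCast_mul
  obtain ⟨m', v', hm', hmq', hhv, hv'⟩ := hh.exists_eq_natCast_mul
  obtain ⟨η, hη⟩ := FractionalIdeal.spanSingleton_eq_spanSingleton.1 (hv'.trans hv.symm)
  rw [Units.smul_def, Algebra.smul_def] at hη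
  have hη' : ((η : 𝓞 K) : K) * v' = v := hη
  obtain ⟨hvL, hvL'⟩ := mem_toLattice_of_spanSingleton_eq ha0 hqf hNa hv
  rw [← hBL.1] at hvL
  rw [← hBL'.1] at hvL'
  -- Since $m\eta h=mm'v=m'g$, the combination $m\eta(h/q-1)-m'(g/q-1)$ equals $m'-m\eta$. It lies
  -- in $L=\mathfrak f\mathfrak b^{-1}$ and is integral, hence lies in $\mathfrak f$.
  have hmη : (m' : 𝓞 K) - m * η ∈ f := by
    refine mem_of_coe_mem_div hb hqf (Ideal.absNorm_mem b) hbq ?_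
    obtain ⟨⟨-, hg1, -⟩, -⟩ := hg
    obtain ⟨⟨-, hh1, -⟩, -⟩ := hh
    have hqK : (q : K) ≠ 0 := by exact_mod_cast hq0
    have h1 := sub_mem (Submodule.smul_mem _ (m * η : 𝓞 K) hh1)
      (Submodule.smul_mem _ (m' : 𝓞 K) hg1)
    rw [Algebra.smul_def, Algebra.smul_def] at h1
    have h2 : (((m' : 𝓞 K) - m * η : 𝓞 K) : K) =
        algebraMap (𝓞 K) K (m * η) * (h / q - 1) - algebraMap (𝓞 K) K m' * (g / q - 1) := by
      simp only [map_sub, map_mul, map_natCast, hgv, hhv, ← hη']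
      field_simp
      ring
    rw [h2]
    exact h1
  -- Modulo $\mathfrak f$, $m'n_0\eta\equiv m\eta\equiv m'$, and $m'$ is invertible because it is
  -- prime to $q$; the Bézout coefficients `s`, `t` make this explicit.
  have hn0 : ∃ x : UnitPairs f q, ((x.1.1 : (ZMod q)ˣ) : ZMod q) * m' = m ∧ x.1.2 = η := by
    set n₀ : (ZMod q)ˣ := ZMod.unitOfCoprime m hmq * (ZMod.unitOfCoprime m' hmq')⁻¹ with hn₀
    have h1 : (n₀ : ZMod q) * m' = m := by
      have h2 : n₀ * ZMod.unitOfCoprime m' hmq' = ZMod.unitOfCoprime m hmq := by simp [hn₀]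
      simpa using congrArg (Units.val) h2
    refine ⟨⟨(n₀, η), ?_⟩, h1, rfl⟩
    obtain ⟨s, t, hst⟩ := Nat.isCoprime_iff_coprime.2 hmq'
    have hst' : (s : 𝓞 K) * m' + t * q = 1 := by
      exact_mod_cast congrArg (Int.cast : ℤ → 𝓞 K) hst
    have h3 : ((n₀ : ZMod q).val : 𝓞 K) * m' - m ∈ f := by
      have := natCast_sub_natCast_mem (K := K) hqf (n := (n₀ : ZMod q).val * m') (n' := m)
        (by simp [h1])
      simpa using this
    have h4 : ((n₀ : ZMod q).val : 𝓞 K) * (η : 𝓞 K) - 1 =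
        s * η * (((n₀ : ZMod q).val : 𝓞 K) * m' - m) - s * ((m' : 𝓞 K) - m * η) +
          t * (((n₀ : ZMod q).val : 𝓞 K) * (η : 𝓞 K) - 1) * q := by
      linear_combination (1 - ((n₀ : ZMod q).val : 𝓞 K) * (η : 𝓞 K)) * hst'
    change ((n₀ : ZMod q).val : 𝓞 K) * (η : 𝓞 K) - 1 ∈ f
    rw [h4]
    exact f.add_mem (f.sub_mem (f.mul_mem_left _ h3) (f.mul_mem_left _ hmη))
      (f.mul_mem_left _ hqf)
  obtain ⟨x₀, hx₀, hx₀η⟩ := hn0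
  have hx₀mem : ((x₀.1.1 : ZMod q).val : 𝓞 K) * (η : 𝓞 K) - 1 ∈ f := hx₀η ▸ x₀.2
  -- The two symmetries combined; a unit congruent to $1$ modulo $\mathfrak f$ has norm $1$.
  have key : ∀ (w : K), w ∈ lat BL → w ∈ lat BL' → ∀ (k k' : ℕ), 0 < k → 0 < k' →
      (k : ZMod q) = k' → ∀ θ : (𝓞 K)ˣ, (θ : 𝓞 K) - 1 ∈ f →
      arithG BL BL' q N σC (unitSystem ε ρ) μ ((k : K) * w) =
        arithG BL BL' q N σC (unitSystem ε ρ) μ (((θ : 𝓞 K) : K) * ((k' : K) * w)) := by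
    intro w hw hw' k k' hk hk' hkk' θ hθ
    rw [arithG_unit_mul _ hBL.1 hBL'.1 (hnorm θ hθ)]
    exact arithG_natCast_mul _ hBL.1 hq0 σC μ hw hw' hk hk' hkk'
  have hηv : v' = (((η⁻¹ : (𝓞 K)ˣ) : 𝓞 K) : K) * v := by
    rw [← hη', ← mul_assoc, ← map_mul, Units.inv_mul, map_one, one_mul]
  constructor
  · refine ⟨Quotient.mk (unitPairsSetoid f q) x₀, fun n η' hrep => ?_⟩
    have hθ := unit_mul_inv_sub_one_mem hqf hx₀mem (hrep.sub_one_mem hqf)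
      (by rw [hrep.natCast_eq, ZMod.natCast_zmod_val]; rfl)
    have := key v hvL hvL' m (n * m') hm (Nat.mul_pos hrep.1 hm')
      (by rw [Nat.cast_mul, hrep.natCast_eq, ← hx₀]; rfl) _ hθ
    rw [hgv, hhv, this, hηv]
    congr 2
    simp only [Units.val_mul, map_mul, Nat.cast_mul]
    ring
  · intro n n' η₁ η₂ h₁ h₂
    -- The factor of `g` at the class `c` is matched with the factor of `h` at $(n_0,\eta)\cdot c$.
    obtain ⟨e, he, hefst⟩ := ZfOne.exists_bijective_fst_eq_mul hqf x₀
    refine finprod_eq_of_bijective e he fun c => ?_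
    have hc₁ := h₁ c
    have hc₂ := h₂ (e c)
    have hθ := unit_mul_inv_sub_one_mem (η := η₁ c * η) (n := n c * (x₀.1.1 : ZMod q).val) hqf
      (by
        rw [Nat.cast_mul, Units.val_mul]
        exact mul_mul_sub_one_mem (hc₁.sub_one_mem hqf) hx₀mem)
      (hc₂.sub_one_mem hqf)
      (by
        rw [Nat.cast_mul, hc₁.natCast_eq, hc₂.natCast_eq, hefst, ZMod.natCast_zmod_val,
          Units.val_mul, mul_comm])
    -- The symmetries are applied to $w=\eta_1v$ rather than to $v$: $\eta_1$ alone need not be $1$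
    -- modulo $\mathfrak f$, but $\theta=\eta_2(\eta_1\eta)^{-1}$ is.
    have hmem : ∀ {C : Module.Basis (Fin (r + 2)) ℚ K} {J : FractionalIdeal (𝓞 K)⁰ K},
        lat C = toLattice J → v ∈ lat C → (((η₁ c : (𝓞 K)ˣ) : 𝓞 K) : K) * v ∈ lat C := by
      intro C J hC hvC
      rw [hC] at hvC ⊢
      exact unit_mul_mem_toLattice _ hvC
    have := key _ (hmem hBL.1 hvL) (hmem hBL'.1 hvL') (n c * m) (n' (e c) * m')
      (Nat.mul_pos hc₁.1 hm) (Nat.mul_pos hc₂.1 hm')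
      (by
        rw [Nat.cast_mul, Nat.cast_mul, hc₁.natCast_eq, hc₂.natCast_eq, hefst, Units.val_mul,
          ← hx₀]
        ring) _ hθ
    have hinv : ((η₁ c : 𝓞 K) : K) * ((((η₁ c)⁻¹ : (𝓞 K)ˣ) : 𝓞 K) : K) = 1 := by
      rw [← map_mul, Units.mul_inv, map_one]
    congr 1
    convert this using 2
    · rw [hgv, Nat.cast_mul]; ring
    · rw [hhv, hηv, mul_inv]
      simp only [Units.val_mul, map_mul, Nat.cast_mul]
      linear_combination (-(n' (e c) : K) * (m' : K) * ((η₂ (e c) : 𝓞 K) : K) *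
        (((η⁻¹ : (𝓞 K)ˣ) : 𝓞 K) : K) * v) * hinv
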